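/- Let $\beta>0$. Let $\mathbf n_\beta(n)=2^{-n-\beta}\frac{\Gamma(\beta+n)}{n!\,\Gamma(\beta)}$, $n\in\mathbb Z_+$ (a probability measure on $\mathbb Z_+$), and let $\ell^2(\mathbf n_\beta)$ be the Hilbert space of real functions on $\mathbb Z_+$ that are square summable with respect to $\mathbf n_\beta$, with inner product $\langle\cdot,\cdot\rangle_{\mathbf n_\beta}$; write $\mathbf n_\beta g=\sum_n \mathbf n_\beta(n)g(n)$ and $\mathrm{var}_{\mathbf n_\beta}(g)=\|g-\mathbf n_\beta g\|_{\ell^2(\mathbf n_\beta)}$ (the norm, not its square). Let $(\mathbb Q_t^{(\beta)})_{t\ge 0}$ be the transition semigroup of the linear birth-death chain on $\mathbb Z_+$ which jumps from $n$ to $n+1$ at rate $n+\beta$ and from $n$ to $n-1$ at rate $n$, let $\mathbb D_\sigma g(n)=\sum_{m=0}^n\binom nm\sigma^m(1-\sigma)^{n-m}g(m)$, and let $\mathbb K_t^{(\beta)}=\mathbb Q^{(\beta)}_{e^t-1}\mathbb D_{e^{-t}}$ be the discrete Laguerre semigroup. For $k\ge 0$ set $$\mathbb L_k^{(\beta)}(n)=\sum_{r=0}^k(-1)^r\binom{k+\beta-1}{k-r}\frac{\Gamma(n+\beta+r)}{2^r\,r!\,\Gamma(n+\beta)},\qquad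 \mathbf c_k(\beta)=\frac{\Gamma(k+1)\Gamma(\beta)}{\Gamma(k+\beta)}.$$ Then $\mathbb L_k^{(\beta)}\in\ell^2(\mathbf n_\beta)$, the functions $\sqrt{2^k\mathbf c_k(\beta)}\,\mathbb L_k^{(\beta)}$, $k\ge0$, are orthonormal in $\ell^2(\mathbf n_\beta)$, and $\mathbb K_t^{(\beta)}\mathbb L_k^{(\beta)}=e^{-kt}\mathbb L_k^{(\beta)}$ for all $t>0$, $k\ge 0$. Moreover, for all $t>0$ and $g\in\ell^2(\mathbf n_\beta)$, the series defining $\mathbb K_t^{(\beta)}g(n)=\sum_m\mathbb Q^{(\beta)}_{e^t-1}(n,m)\,\mathbb D_{e^{-t}}g(m)$ converges absolutely for every $n$, $\mathbb K_t^{(\beta)}g\in\ell^2(\mathbf n_\beta)$, $$\mathbb K_t^{(\beta)}g=\sum_{k=0}^\infty e^{-kt}\,2^k\mathbf c_k(\beta)\,\langle g,\mathbb L_k^{(\beta)}\rangle_{\mathbf n_\beta}\,\mathbb L_k^{(\beta)}\quad\text{in }\ell^2(\mathbf n_\beta),$$ and $\mathrm{var}_{\mathbf n_\beta}(\mathbb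 K_t^{(\beta)}g)\le e^{-t}\,\mathrm{var}_{\mathbf n_\beta}(g)$. -/

import Mathlib

open MeasureTheory
open scoped ENNReal

namespace DiscreteLaguerre

noncomputable section

/-- For the birth-death chain on `ℕ` with birth rates `b` and death rates `d` (nonnegative, with
`d 0 = 0`), `birthDeathApprox b d N t m n` is the probability that the chain started at `m` is at
`n` at time `t` after fewer than `N` jumps. The recursion conditions on the first jump, which occurs
at an exponential time of rate `b m + d m`. For `m = 0` the term with `m - 1` has the factor
`d 0 = 0`. -/
def birthDeathApprox (b d : ℕ → ℝ) : ℕ → ℝ → ℕ → ℕ → ℝ≥0∞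
  | 0, _, _, _ => 0
  | N + 1, t, m, n =>
      (if m = n then ENNReal.ofReal (Real.exp (-((b m + d m) * t))) else 0) +
        ∫⁻ s in Set.Icc 0 t, ENNReal.ofReal (Real.exp (-((b m + d m) * s))) *
          (ENNReal.ofReal (b m) * birthDeathApprox b d N (t - s) (m + 1) n +
            ENNReal.ofReal (d m) * birthDeathApprox b d N (t - s) (m - 1) n)

/-- Transition probabilities of the birth-death chain with rates `b`, `d`: Feller's (minimal)
transition function. -/
def birthDeathTransition (b d : ℕ → ℝ) (t : ℝ) (m n : ℕ) : ℝ :=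
  (⨆ N : ℕ, birthDeathApprox b d N t m n).toReal

/-- Transition probabilities of the linear birth-death chain with generator
`(n + β) ∂₊ + n ∂₋`. -/
def linTransition (β : ℝ) (t : ℝ) (m n : ℕ) : ℝ :=
  birthDeathTransition (fun k => (k : ℝ) + β) (fun k => (k : ℝ)) t m n

/-- The semigroup of the linear birth-death chain, acting on functions. -/
def linSemigroup (β : ℝ) (t : ℝ) (g : ℕ → ℝ) (n : ℕ) : ℝ :=
  ∑' m : ℕ, linTransition β t n m * g m

/-- The binomial (discrete dilation) operator
`𝔻_σ g(n) = ∑_{m ≤ n} (n choose m) σ^m (1 - σ)^(n - m) g(m)`. -/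
def dilation (σ : ℝ) (g : ℕ → ℝ) (n : ℕ) : ℝ :=
  ∑ m ∈ Finset.range (n + 1), (n.choose m : ℝ) * σ ^ m * (1 - σ) ^ (n - m) * g m

/-- The discrete Laguerre semigroup `𝕂_t = ℚ_{e^t - 1} 𝔻_{e^{-t}}`. -/
def laguerreSemigroup (β : ℝ) (t : ℝ) (g : ℕ → ℝ) : ℕ → ℝ :=
  linSemigroup β (Real.exp t - 1) (dilation (Real.exp (-t)) g)

/-- The weight `2^{-n-β} Γ(β + n) / (n! Γ(β))`. -/
def weight (β : ℝ) (n : ℕ) : ℝ :=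
  (2 : ℝ) ^ (-(n : ℝ) - β) * Real.Gamma (β + n) / ((n.factorial : ℝ) * Real.Gamma β)

/-- The negative binomial probability measure on `ℕ` with parameters `1/2` and `β`. -/
def invMeasure (β : ℝ) : Measure ℕ :=
  Measure.sum fun n : ℕ => ENNReal.ofReal (weight β n) • Measure.dirac n

/-- The discrete Laguerre polynomials. -/
def discreteLaguerre (β : ℝ) (k n : ℕ) : ℝ :=
  ∑ r ∈ Finset.range (k + 1), (-1 : ℝ) ^ r * Ring.choose ((k : ℝ) + β - 1) (k - r) *
    (Real.Gamma ((n : ℝ) + β + r) / (2 ^ r * (r.factorial : ℝ) * Real.Gamma ((n : ℝ) + β)))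

/-- The constants `c_k(β) = Γ(k + 1) Γ(β) / Γ(k + β)`. -/
def normConst (β : ℝ) (k : ℕ) : ℝ :=
  Real.Gamma ((k : ℝ) + 1) * Real.Gamma β / Real.Gamma ((k : ℝ) + β)

/-- The distance in `L²(μ)` of `g` to its mean, `‖g - μ g‖` (not squared). -/
def var (μ : Measure ℕ) (g : ℕ → ℝ) : ℝ :=
  (eLpNorm (fun n => g n - ∫ m, g m ∂μ) 2 μ).toReal

end

end DiscreteLaguerre

/-! Write e_i(n) = C(n,i)/(β)_i; in the code this is `shiftedBasis β (i + 1)`. The generator of the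
linear chain sends e_i to e_{i-1}, and 𝔻_σ multiplies e_i by σ^i. Hence ℚ_t acts on polynomials as
the exponential of a nilpotent shift, and 𝕂_t is triangular in the e_i with diagonal entries
e^{-it}. In this basis L_k has coefficients proportional to (-1)^i/(k-i)!, and the binomial theorem
(`sum_mul_sum_factorial`) makes it an eigenvector.

The rates are unbounded, so it must be proved that the minimal transition function integrates e_i to
the polynomial solution of the backward equation. In `tsum_iSup_birthDeathApprox` the error after N
jumps is the N-th term of a series dominated by a finite supersolution, so it tends to zero.

For orthogonality, L_k is also expanded in the rising factorials (n+β)_r. Pairing these with e_i is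
a negative binomial series, and the remaining sum over r is a k-th finite difference of a polynomial
of degree i ≤ k.

A sequence f with ∑ |f(n)| (1+x)^n finite for some x > 0 is determined by its factorial moments,
because its generating function is analytic (`eq_zero_of_tsum_mul_choose_eq_zero`). This is used
twice. The image of the negative binomial law under 𝕂_t has the same factorial moments as the law
itself, so the law is invariant, and Jensen's inequality makes 𝕂_t a contraction of L². Also, a
function orthogonal to every L_k vanishes, so the L_k are complete. A bounded operator that is
diagonal in a Hilbert basis is given by its eigenexpansion, and the factor e^{-t} is Parseval's
identity on the complement of the constants. -/

namespace DiscreteLaguerre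

/-- The part of the backward integral equation that comes from the first jump. -/
noncomputable def jumpOp (b d : ℕ → ℝ) (Φ : ℝ → ℕ → ℝ≥0∞) (t : ℝ) (m : ℕ) : ℝ≥0∞ :=
  ∫⁻ s in Set.Icc 0 t, ENNReal.ofReal (Real.exp (-((b m + d m) * s))) *
    (ENNReal.ofReal (b m) * Φ (t - s) (m + 1) + ENNReal.ofReal (d m) * Φ (t - s) (m - 1))

/-! ### The minimal transition function and the backward integral equation. -/

section BirthDeath

variable {b d : ℕ → ℝ} {Φ Ψ : ℝ → ℕ → ℝ≥0∞}

lemma measurable_jumpOp (hΦ : ∀ m, Measurable fun t => Φ t m) (m : ℕ) :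
    Measurable fun t => jumpOp b d Φ t m := by
  -- The domain of integration depends on t; an indicator turns the claim into joint measurability
  -- in (t, s).
  have h : ∀ t, jumpOp b d Φ t m = ∫⁻ s, (if 0 ≤ s ∧ s ≤ t then
      ENNReal.ofReal (Real.exp (-((b m + d m) * s))) *
      (ENNReal.ofReal (b m) * Φ (t - s) (m + 1) + ENNReal.ofReal (d m) * Φ (t - s) (m - 1))
      else 0) := by
    intro t
    rw [jumpOp, ← lintegral_indicator measurableSet_Icc]
    simp only [Set.indicator_apply, Set.mem_Icc]
  simp_rw [h]
  apply Measurable.lintegral_prod_right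
  refine Measurable.ite ?_ ?_ measurable_const
  · exact (measurableSet_le measurable_const measurable_snd).inter
      (measurableSet_le measurable_snd measurable_fst)
  · have hs : Measurable fun p : ℝ × ℝ => p.1 - p.2 := measurable_fst.sub measurable_snd
    have h1 := (hΦ (m + 1)).comp hs
    have h2 := (hΦ (m - 1)).comp hs
    refine Measurable.mul ?_ ((h1.const_mul _).add (h2.const_mul _))
    fun_prop

lemma jumpOp_mono (h : ∀ t, 0 ≤ t → ∀ m, Φ t m ≤ Ψ t m) (t : ℝ) (m : ℕ) :
    jumpOp b d Φ t m ≤ jumpOp b d Ψ t m := by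
  refine setLIntegral_mono' measurableSet_Icc fun s hs => ?_
  have := h (t - s) (by linarith [hs.2])
  gcongr <;> apply this

lemma jumpOp_congr (h : ∀ t, 0 ≤ t → ∀ m, Φ t m = Ψ t m) (t : ℝ) (m : ℕ) :
    jumpOp b d Φ t m = jumpOp b d Ψ t m :=
  le_antisymm (jumpOp_mono (fun t ht m => (h t ht m).le) t m)
    (jumpOp_mono (fun t ht m => (h t ht m).ge) t m)

lemma measurable_jumpIntegrand (hΦ : ∀ m, Measurable fun t => Φ t m) (t : ℝ) (m : ℕ) :
    Measurable fun s => ENNReal.ofReal (Real.exp (-((b m + d m) * s))) *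
      (ENNReal.ofReal (b m) * Φ (t - s) (m + 1) + ENNReal.ofReal (d m) * Φ (t - s) (m - 1)) := by
  have hs : Measurable fun s : ℝ => t - s := measurable_const.sub measurable_id
  have h1 := (hΦ (m + 1)).comp hs
  have h2 := (hΦ (m - 1)).comp hs
  refine Measurable.mul ?_ ((h1.const_mul _).add (h2.const_mul _))
  fun_prop

lemma jumpOp_add (hΦ : ∀ m, Measurable fun t => Φ t m) (t : ℝ) (m : ℕ) :
    jumpOp b d (fun t m => Φ t m + Ψ t m) t m = jumpOp b d Φ t m + jumpOp b d Ψ t m := by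
  rw [jumpOp, jumpOp, jumpOp, ← lintegral_add_left (measurable_jumpIntegrand hΦ t m)]
  congr 1; funext s; ring

lemma jumpOp_tsum_mul {Φ : ℕ → ℝ → ℕ → ℝ≥0∞} (hΦ : ∀ n m, Measurable fun t => Φ n t m)
    (f : ℕ → ℝ≥0∞) (t : ℝ) (m : ℕ) :
    jumpOp b d (fun t m => ∑' n, Φ n t m * f n) t m = ∑' n, jumpOp b d (Φ n) t m * f n := by
  have h : ∀ n, jumpOp b d (Φ n) t m * f n = ∫⁻ s in Set.Icc 0 t,
      ENNReal.ofReal (Real.exp (-((b m + d m) * s))) * (ENNReal.ofReal (b m) * Φ n (t - s) (m + 1)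
        + ENNReal.ofReal (d m) * Φ n (t - s) (m - 1)) * f n := fun n => by
    rw [lintegral_mul_const _ (measurable_jumpIntegrand (hΦ n) t m)]; rfl
  simp_rw [h]
  rw [← lintegral_tsum
    (fun n => ((measurable_jumpIntegrand (hΦ n) t m).mul_const _).aemeasurable), jumpOp]
  congr 1; funext s
  rw [← ENNReal.tsum_mul_left, ← ENNReal.tsum_mul_left, ← ENNReal.tsum_add,
    ← ENNReal.tsum_mul_left]
  congr 1; funext n; ring

lemma birthDeathApprox_succ (b d : ℕ → ℝ) (N : ℕ) (t : ℝ) (m n : ℕ) :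
    birthDeathApprox b d (N + 1) t m n =
      (if m = n then ENNReal.ofReal (Real.exp (-((b m + d m) * t))) else 0) +
        jumpOp b d (fun t m => birthDeathApprox b d N t m n) t m := rfl

lemma measurable_birthDeathApprox (b d : ℕ → ℝ) (N m n : ℕ) :
    Measurable fun t => birthDeathApprox b d N t m n := by
  induction N generalizing m with
  | zero => exact measurable_const
  | succ N ih =>
    simp_rw [birthDeathApprox_succ]
    refine Measurable.add ?_ (measurable_jumpOp ih m)
    split_ifs <;> fun_prop

lemma birthDeathApprox_mono (b d : ℕ → ℝ) (t : ℝ) (m n : ℕ) :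
    Monotone fun N => birthDeathApprox b d N t m n := by
  refine monotone_nat_of_le_succ fun N => ?_
  induction N generalizing t m with
  | zero => exact zero_le
  | succ N ih =>
    rw [birthDeathApprox_succ, birthDeathApprox_succ]
    gcongr
    exact jumpOp_mono (fun t _ m => ih t m) t m

lemma tsum_birthDeathApprox_succ (b d : ℕ → ℝ) (f : ℕ → ℝ≥0∞) (N : ℕ) (t : ℝ) (m : ℕ) :
    ∑' n, birthDeathApprox b d (N + 1) t m n * f n =
      ENNReal.ofReal (Real.exp (-((b m + d m) * t))) * f m +
        jumpOp b d (fun t m => ∑' n, birthDeathApprox b d N t m n * f n) t m := by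
  rw [jumpOp_tsum_mul (fun n m => measurable_birthDeathApprox b d N m n)]
  simp_rw [birthDeathApprox_succ, add_mul]
  rw [ENNReal.tsum_add]
  congr 1
  rw [tsum_eq_single m (fun n hn => by rw [if_neg (Ne.symm hn), zero_mul]), if_pos rfl]

lemma measurable_iterate_jumpOp (hΦ : ∀ m, Measurable fun t => Φ t m) (N m : ℕ) :
    Measurable fun t => (jumpOp b d)^[N] Φ t m := by
  induction N generalizing m with
  | zero => exact hΦ m
  | succ N ih =>
    simp_rw [Function.iterate_succ_apply']
    exact measurable_jumpOp ih m

/-- The backward equation substituted into itself N times: paths with fewer than N jumps give the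
sum, and the iterate of `jumpOp` is the remainder. No subtraction occurs, so no finiteness is
needed. -/
lemma tsum_birthDeathApprox_add {F : ℝ → ℕ → ℝ≥0∞} {f : ℕ → ℝ≥0∞}
    (hFe : ∀ t, 0 ≤ t → ∀ m, F t m =
      ENNReal.ofReal (Real.exp (-((b m + d m) * t))) * f m + jumpOp b d F t m)
    (N : ℕ) (t : ℝ) (ht : 0 ≤ t) (m : ℕ) :
    ∑' n, birthDeathApprox b d N t m n * f n + (jumpOp b d)^[N] F t m = F t m := by
  induction N generalizing t m with
  | zero => simp [birthDeathApprox]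
  | succ N ih =>
    rw [tsum_birthDeathApprox_succ, Function.iterate_succ_apply', add_assoc, ← jumpOp_add,
      jumpOp_congr ih, ← hFe t ht m]
    exact fun m => Measurable.tsum fun n =>
      (measurable_birthDeathApprox b d N m n).mul_const _

/-- Induction from the monotonicity of `jumpOp`. The bound does not depend on N, so a finite G
forces the remainders above to tend to zero. -/
lemma sum_iterate_jumpOp_le {F G : ℝ → ℕ → ℝ≥0∞} (hF : ∀ m, Measurable fun t => F t m)
    (hG : ∀ t, 0 ≤ t → ∀ m, F t m + jumpOp b d G t m ≤ G t m)
    (N : ℕ) (t : ℝ) (ht : 0 ≤ t) (m : ℕ) :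
    ∑ i ∈ Finset.range N, (jumpOp b d)^[i] F t m ≤ G t m := by
  induction N generalizing t m with
  | zero => simp
  | succ N ih =>
    have hsum : ∀ N t m, jumpOp b d (fun t m => ∑ i ∈ Finset.range N, (jumpOp b d)^[i] F t m) t m
        = ∑ i ∈ Finset.range N, (jumpOp b d)^[i + 1] F t m := by
      intro N
      induction N with
      | zero => intro t m; simp [jumpOp]
      | succ N ihN =>
        intro t m
        simp_rw [Finset.sum_range_succ]
        rw [jumpOp_add, ihN, Function.iterate_succ_apply']
        intro m
        exact Finset.measurable_sum _ fun i _ => measurable_iterate_jumpOp hF i m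
    rw [Finset.sum_range_succ', ← hsum, add_comm]
    refine le_trans ?_ (hG t ht m)
    gcongr
    · exact le_rfl
    · exact jumpOp_mono ih t m

/-- A solution of the backward equation that is dominated by a finite supersolution is given by
the minimal transition function. -/
lemma tsum_iSup_birthDeathApprox {F G : ℝ → ℕ → ℝ≥0∞} {f : ℕ → ℝ≥0∞}
    (hF : ∀ m, Measurable fun t => F t m)
    (hFe : ∀ t, 0 ≤ t → ∀ m, F t m =
      ENNReal.ofReal (Real.exp (-((b m + d m) * t))) * f m + jumpOp b d F t m)
    (hG : ∀ t, 0 ≤ t → ∀ m, F t m + jumpOp b d G t m ≤ G t m)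
    (hGfin : ∀ t m, G t m ≠ ∞) (t : ℝ) (ht : 0 ≤ t) (m : ℕ) :
    ∑' n, (⨆ N, birthDeathApprox b d N t m n) * f n = F t m := by
  -- Monotone convergence for counting measure.
  have h1 : ∑' n, (⨆ N, birthDeathApprox b d N t m n) * f n =
      ⨆ N, ∑' n, birthDeathApprox b d N t m n * f n := by
    simp_rw [ENNReal.iSup_mul, ← lintegral_count]
    rw [lintegral_iSup (fun N => measurable_of_countable _)]
    intro N N' h n
    have := birthDeathApprox_mono b d t m n h
    dsimp only at this ⊢
    gcongr
  rw [h1]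
  have hmono : Monotone fun N => ∑' n, birthDeathApprox b d N t m n * f n := by
    intro N N' h
    refine ENNReal.tsum_le_tsum fun n => ?_
    have := birthDeathApprox_mono b d t m n h
    dsimp only at this ⊢
    gcongr
  have hlim := tendsto_atTop_iSup hmono
  have hsum : ∑' i, (jumpOp b d)^[i] F t m ≠ ∞ := by
    refine ne_top_of_le_ne_top (hGfin t m) ?_
    exact ENNReal.tsum_le_of_sum_range_le fun N => sum_iterate_jumpOp_le hF hG N t ht m
  have hzero := ENNReal.tendsto_atTop_zero_of_tsum_ne_top hsum
  have h2 := hlim.add hzero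
  simp_rw [tsum_birthDeathApprox_add hFe _ t ht m, add_zero] at h2
  exact tendsto_nhds_unique h2 tendsto_const_nhds |>.symm ▸ rfl

end BirthDeath

/-- Duhamel's formula for `H' = S - c H`. -/
lemma ofReal_add_lintegral_exp_mul {H S : ℝ → ℝ} {c : ℝ}
    (hH : ∀ t, HasDerivAt H (S t - c * H t) t) (hS : Continuous S) (hS0 : ∀ t, 0 ≤ t → 0 ≤ S t)
    (hH0 : 0 ≤ H 0) {t : ℝ} (ht : 0 ≤ t) :
    ENNReal.ofReal (Real.exp (-(c * t)) * H 0) +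
      ∫⁻ s in Set.Icc 0 t, ENNReal.ofReal (Real.exp (-(c * s)) * S (t - s)) =
      ENNReal.ofReal (H t) := by
  have hcont : Continuous fun s => Real.exp (-(c * s)) * S (t - s) := by fun_prop
  have hnn : ∀ s ∈ Set.Icc 0 t, 0 ≤ Real.exp (-(c * s)) * S (t - s) := fun s hs =>
    mul_nonneg (Real.exp_pos _).le (hS0 _ (by linarith [hs.2]))
  rw [← ofReal_integral_eq_lintegral_ofReal hcont.integrableOn_Icc
    ((ae_restrict_mem measurableSet_Icc).mono hnn),
    integral_Icc_eq_integral_Ioc, ← intervalIntegral.integral_of_le ht,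
    ← ENNReal.ofReal_add (mul_nonneg (Real.exp_pos _).le hH0)
      (intervalIntegral.integral_nonneg ht hnn)]
  congr 1
  have hd : ∀ s ∈ Set.uIcc 0 t, HasDerivAt (fun s => -(Real.exp (-(c * s)) * H (t - s)))
      (Real.exp (-(c * s)) * S (t - s)) s := by
    intro s _
    have h1 : HasDerivAt (fun s => Real.exp (-(c * s))) (Real.exp (-(c * s)) * -(c * 1)) s :=
      (((hasDerivAt_id s).const_mul c).neg).exp
    have h2 : HasDerivAt (fun s => H (t - s)) ((S (t - s) - c * H (t - s)) * -1) s :=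
      (hH (t - s)).comp s ((hasDerivAt_id s).const_sub t)
    refine (h1.mul h2).neg.congr_deriv ?_
    ring
  rw [intervalIntegral.integral_eq_sub_of_hasDerivAt hd (hcont.intervalIntegrable _ _)]
  simp

lemma jumpOp_ofReal {b d : ℕ → ℝ} (hb : ∀ m, 0 ≤ b m) (hd : ∀ m, 0 ≤ d m) {X : ℝ → ℕ → ℝ}
    (hX : ∀ t, 0 ≤ t → ∀ m, 0 ≤ X t m) (t : ℝ) (m : ℕ) :
    jumpOp b d (fun t m => ENNReal.ofReal (X t m)) t m =
      ∫⁻ s in Set.Icc 0 t, ENNReal.ofReal (Real.exp (-((b m + d m) * s)) *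
        (b m * X (t - s) (m + 1) + d m * X (t - s) (m - 1))) := by
  refine setLIntegral_congr_fun measurableSet_Icc fun s hs => ?_
  have h0 : 0 ≤ t - s := by linarith [hs.2]
  have h1 := mul_nonneg (hb m) (hX _ h0 (m + 1))
  have h2 := mul_nonneg (hd m) (hX _ h0 (m - 1))
  rw [ENNReal.ofReal_mul (Real.exp_pos _).le, ENNReal.ofReal_add h1 h2,
    ENNReal.ofReal_mul (hb m), ENNReal.ofReal_mul (hd m)]

/-! ### Polynomials on which the generator acts as a lowering operator. -/

/-- The rising factorial `(β)_i`. -/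
noncomputable def rising (β : ℝ) (i : ℕ) : ℝ := (ascPochhammer ℝ i).eval β

lemma rising_zero (β : ℝ) : rising β 0 = 1 := by simp [rising]

lemma rising_succ (β : ℝ) (i : ℕ) : rising β (i + 1) = rising β i * (β + i) := by
  simp [rising, ascPochhammer_succ_eval]

lemma rising_pos {β : ℝ} (hβ : 0 < β) (i : ℕ) : 0 < rising β i := ascPochhammer_pos i β hβ

/-- The polynomials `C(n, i) / (β)_i`, with the index shifted by one. -/
noncomputable def shiftedBasis (β : ℝ) : ℕ → ℕ → ℝ
  | 0, _ => 0
  | i + 1, n => (n.choose i : ℝ) / rising β i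

lemma shiftedBasis_nonneg {β : ℝ} (hβ : 0 < β) (i n : ℕ) : 0 ≤ shiftedBasis β i n := by
  cases i with
  | zero => exact le_rfl
  | succ i => exact div_nonneg (Nat.cast_nonneg _) (rising_pos hβ i).le

lemma natCast_mul_choose_sub (m k : ℕ) :
    (m : ℝ) * (m.choose k - (m - 1).choose k) = k * m.choose k := by
  cases m with
  | zero => cases k <;> simp
  | succ p =>
    cases k with
    | zero => simp
    | succ j =>
      have h := Nat.add_one_mul_choose_eq p j
      have h' : ((p : ℝ) + 1) * p.choose j = (p + 1).choose (j + 1) * (j + 1) := by exact_mod_cast h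
      have h2 : ((p + 1).choose (j + 1) : ℝ) = p.choose j + p.choose (j + 1) := by
        exact_mod_cast Nat.choose_succ_succ p j
      rw [Nat.add_sub_cancel]
      push_cast
      rw [h2] at h' ⊢
      linarith

lemma natCast_mul_choose (m k : ℕ) :
    (m : ℝ) * m.choose k = (k + 1) * m.choose (k + 1) + k * m.choose k := by
  have h := Nat.add_one_mul_choose_eq m k
  have h' : ((m : ℝ) + 1) * m.choose k = (m + 1).choose (k + 1) * (k + 1) := by exact_mod_cast h
  have h2 : ((m + 1).choose (k + 1) : ℝ) = m.choose k + m.choose (k + 1) := by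
    exact_mod_cast Nat.choose_succ_succ m k
  rw [h2] at h'
  linarith

/-- The generator lowers the index. -/
lemma generator_shiftedBasis {β : ℝ} (hβ : 0 < β) (i m : ℕ) :
    ((m : ℝ) + β) * (shiftedBasis β i (m + 1) - shiftedBasis β i m) +
      m * (shiftedBasis β i (m - 1) - shiftedBasis β i m) = shiftedBasis β (i - 1) m := by
  match i with
  -- Index 0 carries the zero function, so the truncated subtraction `i - 1` is harmless.
  | 0 => simp [shiftedBasis]
  | 1 => simp [shiftedBasis]
  | k + 2 =>
    have h1 : ((m + 1).choose (k + 1) : ℝ) = m.choose k + m.choose (k + 1) := by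
      exact_mod_cast Nat.choose_succ_succ m k
    have h2 : (m : ℝ) * (m.choose (k + 1) - (m - 1).choose (k + 1)) = m * (m - 1).choose k := by
      cases m with
      | zero => simp
      | succ p =>
        have : ((p + 1).choose (k + 1) : ℝ) = p.choose k + p.choose (k + 1) := by
          exact_mod_cast Nat.choose_succ_succ p k
        rw [this]; simp
    have h3 := natCast_mul_choose_sub m k
    have hk : (β + k : ℝ) ≠ 0 := by positivity
    have hr := (rising_pos hβ k).ne'
    simp only [shiftedBasis, rising_succ, h1, Nat.add_succ_sub_one]
    field_simp
    linarith

/-- The total jump rate 2m + β is unbounded, but multiplication by it raises the index by at most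
one. The crude constant is uniform in i ≤ r, so the bound passes to `evolvedBasis`. -/
lemma two_mul_add_mul_shiftedBasis_le {β : ℝ} (hβ : 0 < β) {i r : ℕ} (hi : i ≤ r) (m : ℕ) :
    (2 * m + β) * shiftedBasis β i m ≤
      2 * (r + 1) * (β + r + 1) * (shiftedBasis β (i + 1) m + shiftedBasis β i m) := by
  have h0 := shiftedBasis_nonneg hβ i m
  have h1 := shiftedBasis_nonneg hβ (i + 1) m
  cases i with
  | zero => simp only [shiftedBasis, mul_zero] at *; positivity
  | succ k =>
    have hk : (k : ℝ) + 1 ≤ r := by exact_mod_cast hi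
    have hk0 : (0 : ℝ) ≤ k := k.cast_nonneg
    have key : (m : ℝ) * shiftedBasis β (k + 1) m =
        (k + 1) * (β + k) * shiftedBasis β (k + 2) m + k * shiftedBasis β (k + 1) m := by
      have hk : (β + k : ℝ) ≠ 0 := by positivity
      have hr := (rising_pos hβ k).ne'
      have := natCast_mul_choose m k
      simp only [shiftedBasis, rising_succ]
      field_simp
      linarith
    have e : (2 * m + β) * shiftedBasis β (k + 1) m =
        2 * (k + 1) * (β + k) * shiftedBasis β (k + 2) m +
          (2 * k + β) * shiftedBasis β (k + 1) m := by linear_combination 2 * key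
    rw [e, mul_add (2 * ((r : ℝ) + 1) * (β + r + 1))]
    have c1 : 2 * ((k : ℝ) + 1) * (β + k) ≤ 2 * (r + 1) * (β + r + 1) :=
      mul_le_mul (by linarith) (by linarith) (by positivity) (by positivity)
    have c2 : 2 * (k : ℝ) + β ≤ 2 * (r + 1) * (β + r + 1) := by nlinarith
    exact add_le_add (mul_le_mul_of_nonneg_right c1 h1) (mul_le_mul_of_nonneg_right c2 h0)

/-- The action of the linear birth-death semigroup on `shiftedBasis`. -/
noncomputable def evolvedBasis (β : ℝ) (r : ℕ) (t : ℝ) (m : ℕ) : ℝ :=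
  ∑ j ∈ Finset.range r, t ^ j / (j.factorial : ℝ) * shiftedBasis β (r - j) m

lemma evolvedBasis_nonneg {β : ℝ} (hβ : 0 < β) (r : ℕ) {t : ℝ} (ht : 0 ≤ t) (m : ℕ) :
    0 ≤ evolvedBasis β r t m :=
  Finset.sum_nonneg fun j _ => mul_nonneg (by positivity) (shiftedBasis_nonneg hβ _ _)

lemma evolvedBasis_zero_time (β : ℝ) (r m : ℕ) : evolvedBasis β r 0 m = shiftedBasis β r m := by
  cases r with
  | zero => simp [evolvedBasis, shiftedBasis]
  | succ r =>
    rw [evolvedBasis, Finset.sum_range_succ']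
    simp

lemma hasDerivAt_evolvedBasis (β : ℝ) (r m : ℕ) (t : ℝ) :
    HasDerivAt (fun t => evolvedBasis β r t m) (evolvedBasis β (r - 1) t m) t := by
  cases r with
  | zero => simpa [evolvedBasis] using hasDerivAt_const t (0 : ℝ)
  | succ r =>
    have h : HasDerivAt (fun t => evolvedBasis β (r + 1) t m)
        (∑ j ∈ Finset.range (r + 1), ((j : ℕ) * t ^ (j - 1)) / (j.factorial : ℝ) *
          shiftedBasis β (r + 1 - j) m) t := by
      refine HasDerivAt.fun_sum fun j _ => ?_
      exact ((hasDerivAt_pow j t).div_const _).mul_const _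
    refine h.congr_deriv ?_
    rw [Finset.sum_range_succ', evolvedBasis]
    simp only [Nat.cast_zero, zero_mul, zero_div, add_zero, Nat.add_sub_cancel]
    refine Finset.sum_congr rfl fun j _ => ?_
    rw [Nat.factorial_succ, Nat.add_sub_add_right]
    congr 1
    push_cast
    have : (j : ℝ) + 1 ≠ 0 := by positivity
    field_simp

/-- The generator and the time derivative (`hasDerivAt_evolvedBasis`) both lower r by one, so
`evolvedBasis` solves the backward equation. The last summand drops to index 0 and disappears. -/
lemma generator_evolvedBasis {β : ℝ} (hβ : 0 < β) (r : ℕ) (t : ℝ) (m : ℕ) :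
    ((m : ℝ) + β) * (evolvedBasis β r t (m + 1) - evolvedBasis β r t m) +
      m * (evolvedBasis β r t (m - 1) - evolvedBasis β r t m) = evolvedBasis β (r - 1) t m := by
  have h : ((m : ℝ) + β) * (evolvedBasis β r t (m + 1) - evolvedBasis β r t m) +
      m * (evolvedBasis β r t (m - 1) - evolvedBasis β r t m) =
      ∑ j ∈ Finset.range r, t ^ j / (j.factorial : ℝ) * shiftedBasis β (r - j - 1) m := by
    simp only [evolvedBasis, ← Finset.sum_sub_distrib, Finset.mul_sum, ← Finset.sum_add_distrib]
    refine Finset.sum_congr rfl fun j _ => ?_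
    rw [← generator_shiftedBasis hβ]
    ring
  rw [h, evolvedBasis]
  cases r with
  | zero => simp
  | succ r =>
    rw [Finset.sum_range_succ]
    simp only [Nat.add_sub_cancel_left, Nat.sub_self, shiftedBasis, mul_zero, add_zero,
      Nat.add_sub_cancel]
    refine Finset.sum_congr rfl fun j _ => ?_
    rw [Nat.sub_right_comm, Nat.add_sub_cancel]

lemma two_mul_add_mul_evolvedBasis_le {β : ℝ} (hβ : 0 < β) (r : ℕ) {t : ℝ} (ht : 0 ≤ t) (m : ℕ) :
    (2 * m + β) * evolvedBasis β r t m ≤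
      2 * (r + 1) * (β + r + 1) * (evolvedBasis β (r + 1) t m + evolvedBasis β r t m) := by
  have h : ∑ j ∈ Finset.range r, t ^ j / (j.factorial : ℝ) * shiftedBasis β (r - j + 1) m ≤
      evolvedBasis β (r + 1) t m := by
    rw [evolvedBasis, Finset.sum_range_succ]
    have h0 : 0 ≤ t ^ r / (r.factorial : ℝ) * shiftedBasis β (r + 1 - r) m :=
      mul_nonneg (by positivity) (shiftedBasis_nonneg hβ _ _)
    have e : ∑ j ∈ Finset.range r, t ^ j / (j.factorial : ℝ) * shiftedBasis β (r - j + 1) m =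
        ∑ j ∈ Finset.range r, t ^ j / (j.factorial : ℝ) * shiftedBasis β (r + 1 - j) m := by
      refine Finset.sum_congr rfl fun j hj => ?_
      rw [Nat.sub_add_comm (Finset.mem_range.mp hj).le]
    linarith
  calc (2 * m + β) * evolvedBasis β r t m
      = ∑ j ∈ Finset.range r, t ^ j / (j.factorial : ℝ) *
          ((2 * m + β) * shiftedBasis β (r - j) m) := by
        rw [evolvedBasis, Finset.mul_sum]
        exact Finset.sum_congr rfl fun j _ => by ring
    _ ≤ ∑ j ∈ Finset.range r, t ^ j / (j.factorial : ℝ) * (2 * (r + 1) * (β + r + 1) *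
          (shiftedBasis β (r - j + 1) m + shiftedBasis β (r - j) m)) := by
        refine Finset.sum_le_sum fun j _ => ?_
        exact mul_le_mul_of_nonneg_left (two_mul_add_mul_shiftedBasis_le hβ (Nat.sub_le r j) m)
          (by positivity)
    _ = 2 * (r + 1) * (β + r + 1) * (∑ j ∈ Finset.range r, t ^ j / (j.factorial : ℝ) *
          shiftedBasis β (r - j + 1) m + evolvedBasis β r t m) := by
        rw [evolvedBasis, ← Finset.sum_add_distrib, Finset.mul_sum]
        exact Finset.sum_congr rfl fun j _ => by ring
    _ ≤ _ := by gcongr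

lemma continuous_evolvedBasis (β : ℝ) (r m : ℕ) : Continuous fun t => evolvedBasis β r t m := by
  unfold evolvedBasis
  fun_prop

lemma tsum_iSup_mul_shiftedBasis {β : ℝ} (hβ : 0 < β) (r : ℕ) {t : ℝ} (ht : 0 ≤ t) (m : ℕ) :
    ∑' n, (⨆ N, birthDeathApprox (fun k => (k : ℝ) + β) (fun k => (k : ℝ)) N t m n) *
      ENNReal.ofReal (shiftedBasis β r n) = ENNReal.ofReal (evolvedBasis β r t m) := by
  have hb : ∀ m : ℕ, 0 ≤ (fun k : ℕ => (k : ℝ) + β) m := fun m => by positivity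
  have hd : ∀ m : ℕ, 0 ≤ (fun k : ℕ => (k : ℝ)) m := fun m => m.cast_nonneg
  set C : ℝ := 2 * (r + 1) * (β + r + 1) with hC
  have hC0 : 0 ≤ C := by positivity
  -- With E_r for `evolvedBasis β r`, the jump inflow of E_r is E_{r-1} + (2m+β) E_r, and Z
  -- dominates it. Z itself solves the backward equation, so t Z solves it with source Z and initial
  -- value 0; hence E_r + t Z is a supersolution.
  set Z : ℝ → ℕ → ℝ := fun t m => evolvedBasis β (r - 1) t m +
    C * (evolvedBasis β (r + 1) t m + evolvedBasis β r t m) with hZ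
  set Z' : ℝ → ℕ → ℝ := fun t m => evolvedBasis β (r - 1 - 1) t m +
    C * (evolvedBasis β r t m + evolvedBasis β (r - 1) t m) with hZ'
  have hZ0 : ∀ t, 0 ≤ t → ∀ m, 0 ≤ Z t m := fun t ht m => by
    have h1 := evolvedBasis_nonneg hβ (r - 1) ht m
    have h2 := evolvedBasis_nonneg hβ (r + 1) ht m
    have h3 := evolvedBasis_nonneg hβ r ht m
    simp only [hZ]; positivity
  have hZc : ∀ m, Continuous fun t => Z t m := fun m =>
    (continuous_evolvedBasis β _ m).add
      (((continuous_evolvedBasis β _ m).add (continuous_evolvedBasis β _ m)).const_mul C)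
  have hZd : ∀ m t, HasDerivAt (fun t => Z t m) (Z' t m) t := fun m t =>
    (hasDerivAt_evolvedBasis β _ m t).add
      (((hasDerivAt_evolvedBasis β _ m t).add (hasDerivAt_evolvedBasis β _ m t)).const_mul C)
  have hZg : ∀ (t : ℝ) (m : ℕ), ((m : ℝ) + β) * Z t (m + 1) + m * Z t (m - 1) =
      Z' t m + ((m : ℝ) + β + m) * Z t m := fun t m => by
    have h1 := generator_evolvedBasis hβ (r - 1) t m
    have h2 := generator_evolvedBasis hβ (r + 1) t m
    have h3 := generator_evolvedBasis hβ r t m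
    rw [Nat.add_sub_cancel] at h2
    simp only [hZ, hZ']
    linear_combination h1 + C * h2 + C * h3
  refine tsum_iSup_birthDeathApprox
    (F := fun t m => ENNReal.ofReal (evolvedBasis β r t m))
    (G := fun t m => ENNReal.ofReal (evolvedBasis β r t m + t * Z t m))
    (f := fun n => ENNReal.ofReal (shiftedBasis β r n)) ?_ ?_ ?_ ?_ t ht m
  · exact fun m => (continuous_evolvedBasis β r m).measurable.ennreal_ofReal
  · intro t ht m
    rw [jumpOp_ofReal hb hd (fun t ht m => evolvedBasis_nonneg hβ r ht m),
      ← ENNReal.ofReal_mul (Real.exp_pos _).le, ← evolvedBasis_zero_time]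
    refine (ofReal_add_lintegral_exp_mul (H := fun t => evolvedBasis β r t m)
      (S := fun t => (m + β) * evolvedBasis β r t (m + 1) + m * evolvedBasis β r t (m - 1))
      (c := m + β + m) (fun s => ?_) ?_ (fun s hs => ?_) ?_ ht).symm
    · refine (hasDerivAt_evolvedBasis β r m s).congr_deriv ?_
      rw [← generator_evolvedBasis hβ]; ring
    · exact ((continuous_evolvedBasis β r _).const_mul _).add
        ((continuous_evolvedBasis β r _).const_mul _)
    · have h1 := evolvedBasis_nonneg hβ r hs (m + 1)
      have h2 := evolvedBasis_nonneg hβ r hs (m - 1)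
      positivity
    · exact evolvedBasis_nonneg hβ r le_rfl m
  · intro t ht m
    have hE := evolvedBasis_nonneg hβ r ht m
    have htZ := mul_nonneg ht (hZ0 t ht m)
    rw [ENNReal.ofReal_add hE htZ]
    gcongr
    rw [jumpOp_ofReal hb hd (fun t ht m =>
      add_nonneg (evolvedBasis_nonneg hβ r ht m) (mul_nonneg ht (hZ0 t ht m)))]
    have hS : ∀ t, 0 ≤ t → ((m : ℝ) + β) * (evolvedBasis β r t (m + 1) + t * Z t (m + 1)) +
        m * (evolvedBasis β r t (m - 1) + t * Z t (m - 1)) ≤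
        Z t m + t * (((m : ℝ) + β) * Z t (m + 1) + m * Z t (m - 1)) := fun t ht => by
      have h1 := generator_evolvedBasis hβ r t m
      have h2 := two_mul_add_mul_evolvedBasis_le hβ r ht m
      rw [← hC] at h2
      simp only [hZ] at *
      linarith
    have key := ofReal_add_lintegral_exp_mul (H := fun t => t * Z t m)
      (S := fun t => Z t m + t * (((m : ℝ) + β) * Z t (m + 1) + m * Z t (m - 1)))
      (c := m + β + m) (fun s => by
        refine ((hasDerivAt_id s).mul (hZd m s)).congr_deriv ?_
        rw [hZg]; simp; ring)
      ((hZc m).add (continuous_id.mul (((hZc _).const_mul _).add ((hZc _).const_mul _))))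
      (fun s hs => by
        have h1 := hZ0 s hs (m + 1)
        have h2 := hZ0 s hs (m - 1)
        have h3 := hZ0 s hs m
        positivity) (by simp) ht
    simp only [zero_mul, mul_zero, ENNReal.ofReal_zero, zero_add] at key
    rw [← key]
    refine setLIntegral_mono' measurableSet_Icc fun s hs => ?_
    have := hS (t - s) (by linarith [hs.2])
    gcongr
  · exact fun _ _ => ENNReal.ofReal_ne_top

lemma hasSum_of_tsum_ofReal {ι : Type*} {f : ι → ℝ} {a : ℝ} (hf : ∀ i, 0 ≤ f i) (ha : 0 ≤ a)
    (h : ∑' i, ENNReal.ofReal (f i) = ENNReal.ofReal a) : HasSum f a := by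
  have hs : Summable f := by
    have := ENNReal.summable_toReal (h.trans_ne ENNReal.ofReal_ne_top)
    simpa only [ENNReal.toReal_ofReal (hf _)] using this
  rw [← ENNReal.ofReal_tsum_of_nonneg hf hs,
    ENNReal.ofReal_eq_ofReal_iff (tsum_nonneg hf) ha] at h
  exact h ▸ hs.hasSum

/-! ### Factorial moments and total mass of the linear chain. -/

section Transition

variable {β : ℝ} {t : ℝ}

lemma linTransition_nonneg (β t : ℝ) (m n : ℕ) : 0 ≤ linTransition β t m n :=
  ENNReal.toReal_nonneg

/-- Index 1 of `shiftedBasis` is the constant 1, so the total mass is finite and `toReal` loses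
nothing. -/
lemma ofReal_linTransition (hβ : 0 < β) (ht : 0 ≤ t) (m n : ℕ) :
    ENNReal.ofReal (linTransition β t m n) =
      ⨆ N, birthDeathApprox (fun k => (k : ℝ) + β) (fun k => (k : ℝ)) N t m n := by
  refine ENNReal.ofReal_toReal ?_
  have h := tsum_iSup_mul_shiftedBasis hβ 1 ht m
  simp only [shiftedBasis, rising_zero, Nat.choose_zero_right, Nat.cast_one, div_one,
    ENNReal.ofReal_one, mul_one] at h
  exact ENNReal.ne_top_of_tsum_ne_top (h.trans_ne ENNReal.ofReal_ne_top) n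

lemma hasSum_linTransition_mul_shiftedBasis (hβ : 0 < β) (ht : 0 ≤ t) (r m : ℕ) :
    HasSum (fun n => linTransition β t m n * shiftedBasis β r n) (evolvedBasis β r t m) := by
  refine hasSum_of_tsum_ofReal
    (fun n => mul_nonneg (linTransition_nonneg β t m n) (shiftedBasis_nonneg hβ r n))
    (evolvedBasis_nonneg hβ r ht m) ?_
  rw [← tsum_iSup_mul_shiftedBasis hβ r ht m]
  refine tsum_congr fun n => ?_
  rw [ENNReal.ofReal_mul (linTransition_nonneg β t m n), ofReal_linTransition hβ ht]

lemma hasSum_linTransition (hβ : 0 < β) (ht : 0 ≤ t) (m : ℕ) :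
    HasSum (linTransition β t m) 1 := by
  simpa [shiftedBasis, evolvedBasis, rising_zero] using
    hasSum_linTransition_mul_shiftedBasis hβ ht 1 m

end Transition

/-! ### The dilation operator and the eigenfunctions of the semigroup. -/

lemma dilation_finset_sum {ι : Type*} (σ : ℝ) (s : Finset ι) (a : ι → ℝ) (g : ι → ℕ → ℝ) (n : ℕ) :
    dilation σ (fun m => ∑ i ∈ s, a i * g i m) n = ∑ i ∈ s, a i * dilation σ (g i) n := by
  simp only [dilation, Finset.mul_sum]
  rw [Finset.sum_comm]
  refine Finset.sum_congr rfl fun i _ => Finset.sum_congr rfl fun m _ => by ring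

/-- A factorial moment of the binomial law: C(n,m) C(m,i) = C(n,i) C(n-i,m-i), then the binomial
theorem. -/
lemma dilation_choose (σ : ℝ) (i n : ℕ) :
    dilation σ (fun m => (m.choose i : ℝ)) n = σ ^ i * n.choose i := by
  unfold dilation
  rcases lt_or_ge n i with hni | hin
  · rw [Nat.choose_eq_zero_of_lt hni, Nat.cast_zero, mul_zero]
    refine Finset.sum_eq_zero fun m hm => ?_
    dsimp only
    rw [Nat.choose_eq_zero_of_lt (lt_of_le_of_lt (Finset.mem_range_succ_iff.mp hm) hni)]
    simp
  · obtain ⟨p, rfl⟩ := Nat.exists_eq_add_of_le hin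
    rw [add_assoc, Finset.sum_range_add, Finset.sum_eq_zero, zero_add]
    · have h := add_pow σ (1 - σ) p
      rw [add_sub_cancel, one_pow] at h
      refine Eq.trans ?_ (congrArg (fun x => σ ^ i * ((i + p).choose i : ℝ) * x) h.symm |>.trans
        (mul_one _))
      rw [Finset.mul_sum]
      refine Finset.sum_congr rfl fun l hl => ?_
      have hl' := Finset.mem_range_succ_iff.mp hl
      have hc : ((i + p).choose (i + l) : ℝ) * (i + l).choose i =
          (i + p).choose i * p.choose l := by
        have := Nat.choose_mul (n := i + p) (k := i + l) (s := i) (by omega)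
        rw [Nat.add_sub_cancel_left, Nat.add_sub_cancel_left] at this
        exact_mod_cast this
      rw [Nat.add_sub_add_left, pow_add]
      linear_combination σ ^ i * σ ^ l * (1 - σ) ^ (p - l) * hc
    · intro m hm
      dsimp only
      rw [Nat.choose_eq_zero_of_lt (Finset.mem_range.mp hm)]
      simp

lemma dilation_shiftedBasis (σ β : ℝ) (i n : ℕ) :
    dilation σ (shiftedBasis β (i + 1)) n = σ ^ i * shiftedBasis β (i + 1) n := by
  have h := dilation_finset_sum σ {()} (fun _ => (rising β i)⁻¹)
    (fun _ m => (m.choose i : ℝ)) n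
  simp only [Finset.sum_singleton, dilation_choose] at h
  have e : shiftedBasis β (i + 1) = fun m => (rising β i)⁻¹ * (m.choose i : ℝ) := by
    funext m; simp [shiftedBasis, div_eq_inv_mul]
  rw [e, h]; ring

lemma evolvedBasis_succ (β : ℝ) (i : ℕ) (t : ℝ) (n : ℕ) :
    evolvedBasis β (i + 1) t n =
      ∑ j ∈ Finset.range (i + 1), t ^ (i - j) / ((i - j).factorial : ℝ) *
        shiftedBasis β (j + 1) n := by
  rw [evolvedBasis, ← Finset.sum_range_reflect]
  refine Finset.sum_congr rfl fun j hj => ?_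
  have := Finset.mem_range_succ_iff.mp hj
  rw [Nat.add_sub_cancel, show i + 1 - (i - j) = j + 1 by omega]

lemma hasSum_linTransition_mul_dilation {β t : ℝ} (hβ : 0 < β) (ht : 0 ≤ t) (k : ℕ) (a : ℕ → ℝ)
    (n : ℕ) :
    HasSum (fun m => linTransition β (Real.exp t - 1) n m * dilation (Real.exp (-t))
        (fun m => ∑ i ∈ Finset.range (k + 1), a i * shiftedBasis β (i + 1) m) m)
      (∑ i ∈ Finset.range (k + 1), a i * (Real.exp (-t) ^ i *
        evolvedBasis β (i + 1) (Real.exp t - 1) n)) := by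
  have hτ : 0 ≤ Real.exp t - 1 := by linarith [Real.one_le_exp ht]
  have h := hasSum_sum (s := Finset.range (k + 1)) fun i _ =>
    ((hasSum_linTransition_mul_shiftedBasis hβ hτ (i + 1) n).mul_left
      (Real.exp (-t) ^ i)).mul_left (a i)
  refine h.congr_fun fun m => ?_
  simp only [dilation_finset_sum, dilation_shiftedBasis, Finset.mul_sum]
  exact Finset.sum_congr rfl fun i _ => by ring

/-- Umbral composition of two exponential factors. -/
lemma sum_mul_sum_factorial (x y : ℝ) (v : ℕ → ℝ) (k : ℕ) :
    ∑ r ∈ Finset.range (k + 1), x ^ r / ((k - r).factorial : ℝ) *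
      ∑ i ∈ Finset.range (r + 1), y ^ (r - i) / ((r - i).factorial : ℝ) * v i =
    ∑ i ∈ Finset.range (k + 1), x ^ i * (1 + x * y) ^ (k - i) / ((k - i).factorial : ℝ) * v i := by
  simp_rw [Finset.mul_sum]
  rw [Finset.sum_comm' (t' := Finset.range (k + 1)) (s' := fun i => Finset.Ico i (k + 1))
    (by simp only [Finset.mem_range, Finset.mem_Ico]; omega)]
  refine Finset.sum_congr rfl fun i hi => ?_
  have hi' := Finset.mem_range_succ_iff.mp hi
  -- For fixed i, put r = i + l; the sum over l is the binomial expansion of (1 + xy)^(k-i).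
  rw [Finset.sum_Ico_eq_sum_range, Nat.sub_add_comm hi', add_comm 1, add_pow]
  simp only [one_pow, mul_one, Finset.mul_sum, Finset.sum_div, Finset.sum_mul]
  refine Finset.sum_congr rfl fun l hl => ?_
  have hl' := Finset.mem_range_succ_iff.mp hl
  rw [Nat.add_sub_cancel_left, ← Nat.sub_sub, Nat.cast_choose ℝ hl', pow_add, mul_pow]
  have h1 : ((k - i - l).factorial : ℝ) ≠ 0 := by positivity
  have h2 : (l.factorial : ℝ) ≠ 0 := by positivity
  have h3 : ((k - i).factorial : ℝ) ≠ 0 := by positivity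
  field_simp

lemma rising_add (β : ℝ) (i j : ℕ) : rising β (i + j) = rising β i * rising (β + i) j := by
  induction j with
  | zero => simp [rising_zero]
  | succ j ih => rw [← add_assoc, rising_succ, rising_succ, ih]; push_cast; ring

lemma gamma_add_natCast {x : ℝ} (hx : 0 < x) (r : ℕ) :
    Real.Gamma (x + r) = rising x r * Real.Gamma x := by
  induction r with
  | zero => simp [rising_zero]
  | succ r ih =>
    rw [rising_succ]
    push_cast
    rw [← add_assoc, Real.Gamma_add_one (by positivity), ih]; ring

lemma ringChoose_eq_rising_div (x : ℝ) (j : ℕ) :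
    Ring.choose (x + j - 1) j = rising x j / j.factorial := by
  rw [← Ring.multichoose_eq, eq_div_iff (by positivity), mul_comm, ← nsmul_eq_mul,
    Ring.factorial_nsmul_multichoose_eq_ascPochhammer, Polynomial.ascPochhammer_smeval_eq_eval]
  rfl

lemma ringChoose_sub_eq {β : ℝ} (hβ : 0 < β) {i r : ℕ} (hi : i ≤ r) :
    Ring.choose ((r : ℝ) + β - 1) (r - i) =
      rising β r / (rising β i * ((r - i).factorial : ℝ)) := by
  obtain ⟨j, rfl⟩ := Nat.exists_eq_add_of_le hi
  have h := ringChoose_eq_rising_div (β + i) j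
  rw [Nat.add_sub_cancel_left, rising_add, mul_div_mul_left _ _ (rising_pos hβ i).ne', ← h]
  congr 1; push_cast; ring

/-- The Chu-Vandermonde expansion of rising factorials. -/
lemma rising_natCast_add {β : ℝ} (hβ : 0 < β) (n r : ℕ) :
    rising (n + β) r / (r.factorial : ℝ) = rising β r *
      ∑ i ∈ Finset.range (r + 1), 1 / ((r - i).factorial : ℝ) * shiftedBasis β (i + 1) n := by
  rw [← ringChoose_eq_rising_div, show (n : ℝ) + β + r - 1 = n + (r + β - 1) by ring,
    Ring.add_choose_eq r (Commute.all _ _), Finset.Nat.sum_antidiagonal_eq_sum_range_succ_mk,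
    Finset.mul_sum]
  refine Finset.sum_congr rfl fun i hi => ?_
  have hi' := Finset.mem_range_succ_iff.mp hi
  rw [ringChoose_sub_eq hβ hi', Ring.choose_natCast, shiftedBasis]
  ring

/-- The form suited to the weight, since (n+β)_r merges with the factor (β)_n of the weight. -/
lemma discreteLaguerre_eq_sum_rising {β : ℝ} (hβ : 0 < β) (k n : ℕ) :
    discreteLaguerre β k n = ∑ r ∈ Finset.range (k + 1),
      rising β k * (-1 / 2) ^ r / ((k - r).factorial : ℝ) *
        (rising (n + β) r / ((r.factorial : ℝ) * rising β r)) := by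
  refine Finset.sum_congr rfl fun r hr => ?_
  have hr' := Finset.mem_range_succ_iff.mp hr
  have h0 : (0 : ℝ) < n + β := by positivity
  have hG := (Real.Gamma_pos_of_pos h0).ne'
  have hr := (rising_pos hβ r).ne'
  rw [ringChoose_sub_eq hβ hr', gamma_add_natCast h0, div_pow]
  field_simp

/-- The form suited to the semigroup. Chu-Vandermonde and umbral composition with x = -1/2, y = 1
give 1 + xy = 1/2, so every power of two collapses to 2^{-k}. -/
lemma discreteLaguerre_eq_sum {β : ℝ} (hβ : 0 < β) (k n : ℕ) :
    discreteLaguerre β k n = ∑ i ∈ Finset.range (k + 1),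
      rising β k / 2 ^ k * ((-1) ^ i / ((k - i).factorial : ℝ)) * shiftedBasis β (i + 1) n := by
  have h := sum_mul_sum_factorial (-1 / 2) 1 (fun i => shiftedBasis β (i + 1) n) k
  rw [discreteLaguerre_eq_sum_rising hβ]
  calc _ = rising β k * ∑ r ∈ Finset.range (k + 1), (-1 / 2) ^ r / ((k - r).factorial : ℝ) *
        ∑ i ∈ Finset.range (r + 1), 1 ^ (r - i) / ((r - i).factorial : ℝ) *
          shiftedBasis β (i + 1) n := by
        rw [Finset.mul_sum]
        refine Finset.sum_congr rfl fun r _ => ?_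
        have hr := (rising_pos hβ r).ne'
        rw [← div_div, rising_natCast_add hβ, mul_div_cancel_left₀ _ hr]
        simp only [one_pow]
        ring
    _ = _ := by
        rw [h, Finset.mul_sum]
        refine Finset.sum_congr rfl fun i hi => ?_
        obtain ⟨j, rfl⟩ := Nat.exists_eq_add_of_le (Finset.mem_range_succ_iff.mp hi)
        rw [Nat.add_sub_cancel_left, div_pow, pow_add 2,
          show (1 + -1 / 2 * 1 : ℝ) = 1 / 2 by norm_num, div_pow, one_pow]
        field_simp

/-- Umbral composition with x = -e^{-t}, y = e^t - 1, for which 1 + xy = e^{-t}; then x^i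
(1+xy)^{k-i} = (-1)^i e^{-kt} for every i. -/
lemma laguerreSemigroup_discreteLaguerre {β t : ℝ} (hβ : 0 < β) (ht : 0 ≤ t) (k n : ℕ) :
    laguerreSemigroup β t (discreteLaguerre β k) n =
      Real.exp (-(k * t)) * discreteLaguerre β k n := by
  have e : discreteLaguerre β k = fun n => ∑ i ∈ Finset.range (k + 1),
      rising β k / 2 ^ k * ((-1) ^ i / ((k - i).factorial : ℝ)) * shiftedBasis β (i + 1) n :=
    funext fun n => discreteLaguerre_eq_sum hβ k n
  have h := (hasSum_linTransition_mul_dilation hβ ht k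
    (fun i => rising β k / 2 ^ k * ((-1) ^ i / ((k - i).factorial : ℝ))) n).tsum_eq
  rw [← e] at h
  rw [laguerreSemigroup, linSemigroup, h, discreteLaguerre_eq_sum hβ]
  have h2 := sum_mul_sum_factorial (-Real.exp (-t)) (Real.exp t - 1)
    (fun i => shiftedBasis β (i + 1) n) k
  have h3 : 1 + -Real.exp (-t) * (Real.exp t - 1) = Real.exp (-t) := by
    have : Real.exp (-t) * Real.exp t = 1 := by rw [← Real.exp_add]; simp
    linarith
  rw [h3] at h2
  calc _ = rising β k / 2 ^ k * ∑ r ∈ Finset.range (k + 1),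
        (-Real.exp (-t)) ^ r / ((k - r).factorial : ℝ) *
        ∑ i ∈ Finset.range (r + 1), (Real.exp t - 1) ^ (r - i) / ((r - i).factorial : ℝ) *
          shiftedBasis β (i + 1) n := by
        rw [Finset.mul_sum]
        refine Finset.sum_congr rfl fun r _ => ?_
        rw [evolvedBasis_succ, neg_pow (Real.exp (-t))]
        ring
    _ = _ := by
        rw [h2, Finset.mul_sum, Finset.mul_sum]
        refine Finset.sum_congr rfl fun i hi => ?_
        have hi' := Finset.mem_range_succ_iff.mp hi
        have e1 : Real.exp (-(k * t)) = Real.exp (-t) ^ i * Real.exp (-t) ^ (k - i) := by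
          rw [← pow_add, Nat.add_sub_cancel' hi', ← Real.exp_nat_mul]; congr 1; ring
        rw [e1, neg_pow (Real.exp (-t))]
        ring

/-! ### Orthogonality with respect to the negative binomial law. -/

section Orthogonality

/-- The negative binomial series. -/
lemma hasSum_rising_div_factorial_mul_pow (a : ℝ) {z : ℝ} (hz : |z| < 1) :
    HasSum (fun n => rising a n / (n.factorial : ℝ) * z ^ n) (1 / (1 - z) ^ a) := by
  have h := (Real.one_div_one_sub_rpow_hasFPowerSeriesOnBall_zero a).hasSum (y := z)
    (by simpa [enorm_eq_nnnorm, ← NNReal.coe_lt_one] using hz)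
  simp only [FormalMultilinearSeries.ofScalars_apply_eq, zero_add, smul_eq_mul] at h
  simpa only [ringChoose_eq_rising_div] using h

variable {β : ℝ}

lemma weight_eq (hβ : 0 < β) (n : ℕ) :
    weight β n = 2 ^ (-β) * (rising β n / (n.factorial : ℝ) * (1 / 2) ^ n) := by
  have hG := (Real.Gamma_pos_of_pos hβ).ne'
  rw [weight, gamma_add_natCast hβ, sub_eq_add_neg, Real.rpow_add two_pos, Real.rpow_neg two_pos.le,
    Real.rpow_natCast, one_div, inv_pow]
  field_simp

lemma weight_pos (hβ : 0 < β) (n : ℕ) : 0 < weight β n := by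
  have := rising_pos hβ n
  rw [weight_eq hβ]
  positivity

lemma summable_weight_mul_pow (hβ : 0 < β) {z : ℝ} (hz0 : 0 ≤ z) (hz : z < 2) :
    Summable fun n => weight β n * z ^ n := by
  have h := (hasSum_rising_div_factorial_mul_pow β (z := z / 2)
    (by rw [abs_of_nonneg (by positivity)]; linarith)).summable.mul_left (2 ^ (-β))
  refine h.congr fun n => ?_
  rw [weight_eq hβ, div_pow, div_pow, one_pow]
  ring

/-- Only n = i + p contributes, and (β)_{i+p} (β+i+p)_r = (β)_{i+r} (β+i+r)_p. This leaves the
negative binomial series with parameter β + i + r at 1/2. -/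
lemma hasSum_weight_mul_rising_mul_choose (hβ : 0 < β) (r i : ℕ) :
    HasSum (fun n : ℕ => weight β n * (rising (n + β) r * n.choose i))
      (2 ^ r * rising β (i + r) / (i.factorial : ℝ)) := by
  have hinj : Function.Injective fun p : ℕ => i + p := fun a b h => by simpa using h
  rw [← hinj.hasSum_iff]
  · have h := (hasSum_rising_div_factorial_mul_pow (β + (i + r : ℕ)) (z := 1 / 2)
      (by norm_num [abs_of_pos])).mul_left
        (2 ^ (-β) * (1 / 2) ^ i * rising β (i + r) / (i.factorial : ℝ))
    have hsum : 2 ^ (-β) * (1 / 2) ^ i * rising β (i + r) / (i.factorial : ℝ) *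
        (1 / (1 - 1 / 2) ^ (β + (i + r : ℕ))) = 2 ^ r * rising β (i + r) / (i.factorial : ℝ) := by
      have e : (1 / (1 - 1 / 2 : ℝ) ^ (β + (i + r : ℕ))) = 2 ^ β * (2 ^ i * 2 ^ r) := by
        rw [← pow_add, ← Real.rpow_natCast, ← Real.rpow_add two_pos,
          show (1 - 1 / 2 : ℝ) = 2⁻¹ by norm_num, Real.inv_rpow two_pos.le, one_div, inv_inv]
      have h2 : (2 : ℝ) ^ β ≠ 0 := (Real.rpow_pos_of_pos two_pos _).ne'
      rw [e, Real.rpow_neg two_pos.le, div_pow, one_pow]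
      field_simp
    rw [hsum] at h
    refine h.congr_fun fun p => ?_
    have h1 : rising β (i + p) * rising ((i + p : ℕ) + β) r =
        rising β (i + r) * rising (β + (i + r : ℕ)) p := by
      rw [← rising_add, add_comm _ β, ← rising_add]
      congr 1; omega
    have h2 : ((i + p).choose i : ℝ) = (i + p).factorial / (i.factorial * p.factorial) := by
      rw [Nat.cast_add_choose]
    simp only [Function.comp_apply]
    rw [weight_eq hβ, h2, pow_add]
    have h3 : ((i + p).factorial : ℝ) ≠ 0 := by positivity
    field_simp
    linear_combination h1
  · intro n hn
    have : n < i := by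
      by_contra! h
      exact hn ⟨n - i, by simp [h]⟩
    rw [Nat.choose_eq_zero_of_lt this]
    simp

lemma integral_invMeasure (hβ : 0 < β) {f : ℕ → ℝ} {s : ℝ}
    (h : HasSum (fun n => weight β n * f n) s) : ∫ n, f n ∂(invMeasure β) = s := by
  have h1 := hasSum_integral_sum_dirac (x := fun n : ℕ => n) (f := f)
    (c := fun n => ENNReal.ofReal (weight β n)) (fun n => ENNReal.ofReal_ne_top) (by
      refine h.summable.abs.congr fun n => ?_
      rw [ENNReal.toReal_ofReal (weight_pos hβ n).le, abs_mul, abs_of_pos (weight_pos hβ n),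
        Real.norm_eq_abs])
  simp only [ENNReal.toReal_ofReal (weight_pos hβ _).le, smul_eq_mul] at h1
  exact h1.unique h

lemma integrable_invMeasure_iff (hβ : 0 < β) {f : ℕ → ℝ} :
    Integrable f (invMeasure β) ↔ Summable fun n => weight β n * |f n| := by
  have := integrable_sum_dirac_iff (x := fun n : ℕ => n) (f := f)
    (c := fun n => ENNReal.ofReal (weight β n)) (fun n => ENNReal.ofReal_ne_top)
  simp only [ENNReal.toReal_ofReal (weight_pos hβ _).le, Real.norm_eq_abs] at this
  exact this

lemma hasSum_integral_invMeasure (hβ : 0 < β) {f : ℕ → ℝ} (hf : Integrable f (invMeasure β)) :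
    HasSum (fun n => weight β n * f n) (∫ n, f n ∂(invMeasure β)) := by
  rw [integrable_invMeasure_iff hβ] at hf
  have hs : Summable fun n => weight β n * f n := by
    rw [← summable_abs_iff]
    refine hf.congr fun n => ?_
    rw [abs_mul, abs_of_pos (weight_pos hβ n)]
  rw [integral_invMeasure hβ hs.hasSum]
  exact hs.hasSum

lemma memLp_two_invMeasure_iff (hβ : 0 < β) {f : ℕ → ℝ} :
    MemLp f 2 (invMeasure β) ↔ Summable fun n => weight β n * f n ^ 2 := by
  rw [memLp_two_iff_integrable_sq (measurable_of_countable f).aestronglyMeasurable,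
    integrable_invMeasure_iff hβ]
  simp only [abs_pow, sq_abs]

lemma memLp_shiftedBasis (hβ : 0 < β) (i : ℕ) :
    MemLp (shiftedBasis β (i + 1)) 2 (invMeasure β) := by
  rw [memLp_two_invMeasure_iff hβ]
  -- The weight tolerates growth z^n with z < 2, and (5/4)² < 2. One term of the expansion of (1/4 +
  -- 1)^n bounds C(n,i) by 4^i (5/4)^n.
  have h := (summable_weight_mul_pow hβ (z := (5 / 4) ^ 2) (by norm_num) (by norm_num)).mul_right
    ((4 ^ i / rising β i) ^ 2)
  refine Summable.of_nonneg_of_le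
    (fun n => mul_nonneg (weight_pos hβ n).le (sq_nonneg _)) (fun n => ?_) h
  have hr := rising_pos hβ i
  have hc : (n.choose i : ℝ) * (1 / 4) ^ i ≤ (5 / 4) ^ n := by
    have h := add_pow (1 / 4 : ℝ) 1 n
    rw [show (1 / 4 + 1 : ℝ) = 5 / 4 by norm_num] at h
    rw [h]
    rcases lt_or_ge n i with hni | hin
    · rw [Nat.choose_eq_zero_of_lt hni, Nat.cast_zero, zero_mul]
      exact Finset.sum_nonneg fun m _ => by positivity
    · have := Finset.single_le_sum
        (f := fun m => (1 / 4 : ℝ) ^ m * 1 ^ (n - m) * (n.choose m : ℝ))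
        (fun m _ => by positivity) (Finset.mem_range_succ_iff.mpr hin)
      refine le_trans (le_of_eq ?_) this
      simp [mul_comm]
  have hb : shiftedBasis β (i + 1) n ≤ (5 / 4) ^ n * (4 ^ i / rising β i) := by
    have e : shiftedBasis β (i + 1) n =
        (n.choose i : ℝ) * (1 / 4) ^ i * (4 ^ i / rising β i) := by
      rw [shiftedBasis, div_pow, one_pow]; field_simp
    rw [e]; gcongr
  have h0 := shiftedBasis_nonneg hβ (i + 1) n
  calc weight β n * shiftedBasis β (i + 1) n ^ 2
      ≤ weight β n * ((5 / 4) ^ n * (4 ^ i / rising β i)) ^ 2 := by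
        have := (weight_pos hβ n).le
        gcongr
    _ = _ := by rw [mul_pow, ← pow_mul, ← pow_mul, mul_comm n 2]; ring

lemma memLp_discreteLaguerre (hβ : 0 < β) (k : ℕ) :
    MemLp (discreteLaguerre β k) 2 (invMeasure β) := by
  have e : discreteLaguerre β k = fun n => ∑ i ∈ Finset.range (k + 1),
      rising β k / 2 ^ k * ((-1) ^ i / ((k - i).factorial : ℝ)) * shiftedBasis β (i + 1) n :=
    funext fun n => discreteLaguerre_eq_sum hβ k n
  rw [e]
  exact memLp_finsetSum _ fun i _ => (memLp_shiftedBasis hβ i).const_mul _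

/-- Up to sign, a k-th forward difference of a monic polynomial of degree i. -/
lemma sum_neg_one_pow_choose_rising (x : ℝ) {i k : ℕ} (hik : i ≤ k) :
    ∑ r ∈ Finset.range (k + 1), (-1 : ℝ) ^ r * k.choose r * rising (x + r) i =
      if i = k then (-1) ^ k * (k.factorial : ℝ) else 0 := by
  have h := fwdDiff_iter_eq_sum_shift (1 : ℝ) (ascPochhammer ℝ i).eval k x
  have e : ∑ r ∈ Finset.range (k + 1), (-1 : ℝ) ^ r * k.choose r * rising (x + r) i =
      (-1) ^ k * (fwdDiff (1 : ℝ))^[k] (ascPochhammer ℝ i).eval x := by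
    rw [h, Finset.mul_sum]
    refine Finset.sum_congr rfl fun r hr => ?_
    obtain ⟨j, rfl⟩ := Nat.exists_eq_add_of_le (Finset.mem_range_succ_iff.mp hr)
    have hj : ((-1 : ℝ) ^ j) * (-1) ^ j = 1 := by rw [← mul_pow]; simp
    rw [Nat.add_sub_cancel_left, zsmul_eq_mul, rising, nsmul_eq_mul, mul_one, pow_add]
    push_cast
    linear_combination -((-1) ^ r * ((r + j).choose r : ℝ) *
      (ascPochhammer ℝ i).eval (x + r)) * hj
  rw [e]
  split_ifs with hk
  · subst hk
    have h1 := Polynomial.fwdDiff_iter_degree_eq_factorial (ascPochhammer ℝ i)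
    rw [ascPochhammer_natDegree, (monic_ascPochhammer ℝ i).leadingCoeff, one_smul] at h1
    rw [h1]; simp
  · have h1 := Polynomial.fwdDiff_iter_eq_zero_of_degree_lt (P := ascPochhammer ℝ i) (n := k)
      (by rw [ascPochhammer_natDegree]; omega)
    rw [h1]; simp

/-- Summed termwise over r, the factor 2^r cancels and (β)_{i+r} = (β)_r (β+r)_i cancels (β)_r,
leaving the alternating sum of (β+r)_i. -/
lemma hasSum_discreteLaguerre_mul_shiftedBasis (hβ : 0 < β) {i k : ℕ} (hik : i ≤ k) :
    HasSum (fun n => weight β n * (discreteLaguerre β k n * shiftedBasis β (i + 1) n))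
      (if i = k then (-1) ^ k / (k.factorial : ℝ) else 0) := by
  have hri := (rising_pos hβ i).ne'
  have h := hasSum_sum (s := Finset.range (k + 1)) fun r _ =>
    (hasSum_weight_mul_rising_mul_choose hβ r i).mul_left
      (rising β k * (-1 / 2) ^ r / ((k - r).factorial : ℝ) / ((r.factorial : ℝ) * rising β r) /
        rising β i)
  have hs : ∑ r ∈ Finset.range (k + 1), rising β k * (-1 / 2) ^ r / ((k - r).factorial : ℝ) /
      ((r.factorial : ℝ) * rising β r) / rising β i *
        (2 ^ r * rising β (i + r) / (i.factorial : ℝ)) =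
      if i = k then (-1) ^ k / (k.factorial : ℝ) else 0 := by
    have h1 := sum_neg_one_pow_choose_rising β hik
    have h2 : ∀ r ∈ Finset.range (k + 1), rising β k * (-1 / 2) ^ r / ((k - r).factorial : ℝ) /
        ((r.factorial : ℝ) * rising β r) / rising β i *
          (2 ^ r * rising β (i + r) / (i.factorial : ℝ)) =
        rising β k / (rising β i * k.factorial * i.factorial) *
          ((-1 : ℝ) ^ r * k.choose r * rising (β + r) i) := by
      intro r hr
      have hrr := (rising_pos hβ r).ne'
      rw [Nat.cast_choose ℝ (Finset.mem_range_succ_iff.mp hr), add_comm i r, rising_add, div_pow]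
      have h3 : (k.factorial : ℝ) ≠ 0 := by positivity
      field_simp
    rw [Finset.sum_congr rfl h2, ← Finset.mul_sum, h1]
    split_ifs with hk
    · subst hk
      field_simp
    · simp
  rw [hs] at h
  refine h.congr_fun fun n => ?_
  rw [discreteLaguerre_eq_sum_rising hβ, shiftedBasis, Finset.sum_mul, Finset.mul_sum]
  refine Finset.sum_congr rfl fun r _ => ?_
  ring

lemma normConst_eq (hβ : 0 < β) (k : ℕ) : normConst β k = k.factorial / rising β k := by
  have hG := (Real.Gamma_pos_of_pos hβ).ne'
  rw [normConst, Real.Gamma_nat_eq_factorial, add_comm, gamma_add_natCast hβ]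
  field_simp

lemma hasSum_discreteLaguerre_mul_of_le (hβ : 0 < β) {j k : ℕ} (hjk : j ≤ k) :
    HasSum (fun n => weight β n * (discreteLaguerre β j n * discreteLaguerre β k n))
      (if j = k then (2 ^ k * normConst β k)⁻¹ else 0) := by
  have h := hasSum_sum (s := Finset.range (j + 1)) fun i hi =>
    (hasSum_discreteLaguerre_mul_shiftedBasis hβ
      (i := i) (k := k) ((Finset.mem_range_succ_iff.mp hi).trans hjk)).mul_left
      (rising β j / 2 ^ j * ((-1) ^ i / ((j - i).factorial : ℝ)))
  have hs : ∑ i ∈ Finset.range (j + 1), rising β j / 2 ^ j * ((-1) ^ i / ((j - i).factorial : ℝ)) *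
      (if i = k then (-1) ^ k / (k.factorial : ℝ) else 0) =
      if j = k then (2 ^ k * normConst β k)⁻¹ else 0 := by
    rw [Finset.sum_range_succ, Finset.sum_eq_zero, zero_add]
    · split_ifs with hk
      · subst hk
        have hj : ((-1 : ℝ) ^ j) * (-1) ^ j = 1 := by rw [← mul_pow]; simp
        have := (rising_pos hβ j).ne'
        rw [normConst_eq hβ, Nat.sub_self, Nat.factorial_zero, Nat.cast_one, div_one]
        field_simp
        linear_combination hj
      · simp
    · intro i hi
      have := Finset.mem_range.mp hi
      rw [if_neg (by omega), mul_zero]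
  rw [hs] at h
  refine h.congr_fun fun n => ?_
  rw [discreteLaguerre_eq_sum hβ j, Finset.sum_mul, Finset.mul_sum]
  refine Finset.sum_congr rfl fun i _ => ?_
  ring

lemma integral_discreteLaguerre_mul (hβ : 0 < β) (j k : ℕ) :
    ∫ n, discreteLaguerre β j n * discreteLaguerre β k n ∂(invMeasure β) =
      if j = k then (2 ^ k * normConst β k)⁻¹ else 0 := by
  rcases le_total j k with h | h
  · exact integral_invMeasure hβ (hasSum_discreteLaguerre_mul_of_le hβ h)
  · have := integral_invMeasure hβ (hasSum_discreteLaguerre_mul_of_le hβ h)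
    simp_rw [mul_comm (discreteLaguerre β k _)] at this
    rw [this]
    rcases eq_or_ne j k with rfl | hne
    · rfl
    · rw [if_neg hne, if_neg hne.symm]

end Orthogonality

/-! ### Determinacy by factorial moments. -/

lemma hasSum_choose_mul_pow (x : ℝ) (n : ℕ) :
    HasSum (fun i => (n.choose i : ℝ) * x ^ i) ((1 + x) ^ n) := by
  have h : HasSum (fun i => (n.choose i : ℝ) * x ^ i)
      (∑ i ∈ Finset.range (n + 1), (n.choose i : ℝ) * x ^ i) :=
    hasSum_sum_of_ne_finset_zero (fun i hi => by
      rw [Nat.choose_eq_zero_of_lt (by simpa [Nat.lt_succ_iff] using hi)]; simp)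
  rw [add_comm 1 x, add_pow]
  simpa [mul_comm] using h

/-- Expand (1+x)^n in powers of x; the absolute summability at 1 + x justifies Fubini. -/
lemma tsum_mul_one_add_pow_eq_zero {f : ℕ → ℝ} {x : ℝ} (hx : 0 ≤ x)
    (hs : Summable fun n => |f n| * (1 + x) ^ n)
    (h : ∀ i, ∑' n, f n * (n.choose i : ℝ) = 0) : ∑' n, f n * (1 + x) ^ n = 0 := by
  have hS : Summable fun p : ℕ × ℕ => f p.1 * ((p.1.choose p.2 : ℝ) * x ^ p.2) := by
    rw [← summable_abs_iff, summable_prod_of_nonneg fun _ => abs_nonneg _]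
    have e : ∀ n i, |f n * ((n.choose i : ℝ) * x ^ i)| = |f n| * ((n.choose i : ℝ) * x ^ i) :=
      fun n i => by rw [abs_mul, abs_of_nonneg (a := (n.choose i : ℝ) * x ^ i) (by positivity)]
    simp only [e, tsum_mul_left, (hasSum_choose_mul_pow x _).tsum_eq]
    exact ⟨fun n => (hasSum_choose_mul_pow x n).summable.mul_left _, hs⟩
  calc ∑' n, f n * (1 + x) ^ n = ∑' n, ∑' i, f n * ((n.choose i : ℝ) * x ^ i) := by
        simp only [tsum_mul_left, (hasSum_choose_mul_pow x _).tsum_eq]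
    _ = ∑' i, ∑' n, f n * ((n.choose i : ℝ) * x ^ i) :=
        (Summable.tsum_comm (f := fun n i => f n * ((n.choose i : ℝ) * x ^ i)) hS).symm
    _ = 0 := by
        simp only [← mul_assoc, tsum_mul_right, h, zero_mul, tsum_zero]

/-- Uniqueness in the moment problem on `ℕ` under an exponential moment bound. -/
theorem eq_zero_of_tsum_mul_choose_eq_zero {f : ℕ → ℝ} {x₀ : ℝ} (hx₀ : 0 < x₀)
    (hs : Summable fun n => |f n| * (1 + x₀) ^ n)
    (h : ∀ i, ∑' n, f n * (n.choose i : ℝ) = 0) : f = 0 := by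
  set p := FormalMultilinearSeries.ofScalars ℝ f with hp
  set R : NNReal := ⟨1 + x₀, by positivity⟩ with hR
  have hR0 : (0 : ℝ≥0∞) < R := by
    rw [ENNReal.coe_pos, ← NNReal.coe_pos]; exact add_pos one_pos hx₀
  have hrad : (R : ℝ≥0∞) ≤ p.radius := by
    refine p.le_radius_of_summable ?_
    refine hs.congr fun n => ?_
    rw [hp, FormalMultilinearSeries.ofScalars_norm]
    rfl
  have hball := (p.hasFPowerSeriesOnBall (hR0.trans_le hrad)).mono hR0 hrad
  have hsum : ∀ x, 0 ≤ x → x ≤ x₀ → p.sum (1 + x) = 0 := by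
    intro x hx hxx
    have := tsum_mul_one_add_pow_eq_zero hx (f := f) (Summable.of_nonneg_of_le
      (fun n => by positivity) (fun n => by gcongr) hs) h
    rw [← this]
    change FormalMultilinearSeries.ofScalarsSum f (1 + x) = _
    rw [FormalMultilinearSeries.ofScalars_sum_eq]
    simp only [smul_eq_mul]
  -- The generating function vanishes around a point inside its disc of radius 1 + x₀, hence on the
  -- whole disc by the identity theorem; its coefficients at 0 are then zero.
  have hz : p.sum =ᶠ[nhds (1 + x₀ / 2)] 0 := by
    filter_upwards [Ioo_mem_nhds (show (1 : ℝ) < 1 + x₀ / 2 by linarith)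
      (show 1 + x₀ / 2 < 1 + x₀ by linarith)] with y hy
    have := hsum (y - 1) (by linarith [hy.1]) (by linarith [hy.2])
    simpa using this
  have hana := hball.analyticOnNhd
  rw [Metric.eball_coe] at hana
  have heq := hana.eqOn_zero_of_preconnected_of_eventuallyEq_zero
    (convex_ball (0 : ℝ) R).isPreconnected (z₀ := 1 + x₀ / 2) (by
      rw [Metric.mem_ball, dist_zero_right, Real.norm_eq_abs, abs_of_pos (by positivity), hR]
      change 1 + x₀ / 2 < 1 + x₀
      linarith) hz
  have h0 : p.sum =ᶠ[nhds 0] 0 :=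
    heq.eventuallyEq_of_mem (Metric.ball_mem_nhds 0 (add_pos one_pos hx₀))
  have hp0 := (hball.hasFPowerSeriesAt.congr h0).eq_zero
  exact (FormalMultilinearSeries.ofScalars_series_eq_zero ℝ).mp hp0

/-! ### Invariance of the negative binomial law. -/

section Moments

variable {β : ℝ}

/-- By Tonelli the sum over m may be taken first; what remains is the series of (β)_i x^i / i!,
convergent for x < 1. -/
lemma summable_mul_pow_of_moments {ν : ℕ → ℝ} (hν : ∀ m, 0 ≤ ν m)
    (h : ∀ i, HasSum (fun m => ν m * (m.choose i : ℝ)) (rising β i / (i.factorial : ℝ)))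
    {x : ℝ} (hx0 : 0 ≤ x) (hx1 : x < 1) : Summable fun m => ν m * (1 + x) ^ m := by
  have hS : Summable fun p : ℕ × ℕ => ν p.2 * ((p.2.choose p.1 : ℝ) * x ^ p.1) := by
    have hnn : 0 ≤ fun p : ℕ × ℕ => ν p.2 * ((p.2.choose p.1 : ℝ) * x ^ p.1) :=
      fun p => mul_nonneg (hν _) (by positivity)
    rw [summable_prod_of_nonneg hnn]
    have hi : ∀ i, HasSum (fun m => ν m * ((m.choose i : ℝ) * x ^ i))
        (rising β i / (i.factorial : ℝ) * x ^ i) := fun i => by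
      simpa only [mul_assoc] using (h i).mul_right (x ^ i)
    simp only [(hi _).tsum_eq]
    exact ⟨fun i => (hi i).summable, (hasSum_rising_div_factorial_mul_pow β
      (by rwa [abs_of_nonneg hx0])).summable⟩
  have := (hS.prod_symm).prod
  simpa only [Prod.fst_swap, Prod.snd_swap, tsum_mul_left,
    (hasSum_choose_mul_pow x _).tsum_eq] using this

lemma hasSum_weight_mul_choose (hβ : 0 < β) (i : ℕ) :
    HasSum (fun m => weight β m * (m.choose i : ℝ)) (rising β i / (i.factorial : ℝ)) := by
  simpa [rising_zero] using hasSum_weight_mul_rising_mul_choose hβ 0 i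

/-- The negative binomial distribution is determined by its factorial moments. -/
lemma eq_weight_of_moments {ν : ℕ → ℝ} (hβ : 0 < β) (hν : ∀ m, 0 ≤ ν m)
    (h : ∀ i, HasSum (fun m => ν m * (m.choose i : ℝ)) (rising β i / (i.factorial : ℝ))) :
    ν = weight β := by
  have hw := summable_mul_pow_of_moments (fun m => (weight_pos hβ m).le)
    (hasSum_weight_mul_choose hβ) (x := 1 / 2) (by norm_num) (by norm_num)
  have hν' := summable_mul_pow_of_moments hν h (x := 1 / 2) (by norm_num) (by norm_num)
  have h0 := eq_zero_of_tsum_mul_choose_eq_zero (f := fun m => ν m - weight β m)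
    (x₀ := 1 / 2) (by norm_num)
    (Summable.of_nonneg_of_le (fun m => by positivity) (fun m => by
      rw [← add_mul]
      gcongr
      exact (abs_sub _ _).trans_eq (by rw [abs_of_nonneg (hν m), abs_of_pos (weight_pos hβ m)]))
      (hν'.add hw))
    (fun i => by
      have := ((h i).sub (hasSum_weight_mul_choose hβ i)).tsum_eq
      simpa only [← sub_mul, sub_self] using this)
  funext m
  exact sub_eq_zero.mp (congrFun h0 m)

/-- The kernel of the dilation operator. -/
noncomputable def dilationKernel (σ : ℝ) (j m : ℕ) : ℝ :=
  (j.choose m : ℝ) * σ ^ m * (1 - σ) ^ (j - m)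

lemma dilationKernel_nonneg {σ : ℝ} (h0 : 0 ≤ σ) (h1 : σ ≤ 1) (j m : ℕ) :
    0 ≤ dilationKernel σ j m := by
  have : 0 ≤ 1 - σ := sub_nonneg.mpr h1
  unfold dilationKernel; positivity

lemma ofReal_dilation {σ : ℝ} (h0 : 0 ≤ σ) (h1 : σ ≤ 1) {g : ℕ → ℝ} (hg : ∀ m, 0 ≤ g m) (j : ℕ) :
    ENNReal.ofReal (dilation σ g j) =
      ∑' m, ENNReal.ofReal (dilationKernel σ j m) * ENNReal.ofReal (g m) := by
  rw [tsum_eq_sum (s := Finset.range (j + 1))]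
  · change ENNReal.ofReal (∑ m ∈ Finset.range (j + 1), dilationKernel σ j m * g m) = _
    rw [ENNReal.ofReal_sum_of_nonneg
      (fun m _ => mul_nonneg (dilationKernel_nonneg h0 h1 j m) (hg m))]
    exact Finset.sum_congr rfl fun m _ => ENNReal.ofReal_mul (dilationKernel_nonneg h0 h1 j m)
  · intro m hm
    rw [dilationKernel, Nat.choose_eq_zero_of_lt (by simpa [Nat.lt_succ_iff] using hm)]
    simp

lemma sum_dilationKernel (σ : ℝ) (j : ℕ) :
    ∑ m ∈ Finset.range (j + 1), dilationKernel σ j m = 1 := by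
  have h := add_pow σ (1 - σ) j
  rw [add_sub_cancel, one_pow] at h
  rw [h]
  exact Finset.sum_congr rfl fun m _ => by rw [dilationKernel]; ring

lemma sq_dilation_le {σ : ℝ} (h0 : 0 ≤ σ) (h1 : σ ≤ 1) (g : ℕ → ℝ) (j : ℕ) :
    dilation σ g j ^ 2 ≤ dilation σ (fun m => g m ^ 2) j :=
  Real.pow_arith_mean_le_arith_mean_pow_of_even _ _ g
    (fun m _ => dilationKernel_nonneg h0 h1 j m) (sum_dilationKernel σ j) even_two

/-- Each e_j has mean 1/j!, and the binomial theorem sums these. At time e^t - 1 the value is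
e^{it}/i!, which the dilation factor e^{-it} cancels. -/
lemma hasSum_weight_mul_evolvedBasis (hβ : 0 < β) (t : ℝ) (i : ℕ) :
    HasSum (fun n => weight β n * evolvedBasis β (i + 1) t n)
      ((t + 1) ^ i / (i.factorial : ℝ)) := by
  have hb : ∀ j, HasSum (fun n => weight β n * shiftedBasis β (j + 1) n)
      (1 / (j.factorial : ℝ)) := fun j => by
    have h := (hasSum_weight_mul_choose hβ j).div_const (rising β j)
    have hr := (rising_pos hβ j).ne'
    have e : rising β j / (j.factorial : ℝ) / rising β j = 1 / (j.factorial : ℝ) := by field_simp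
    rw [e] at h
    exact h.congr_fun fun n => by rw [shiftedBasis, mul_div_assoc]
  have h := hasSum_sum (s := Finset.range (i + 1)) fun j _ =>
    (hb j).mul_left (t ^ (i - j) / ((i - j).factorial : ℝ))
  have e : ∑ j ∈ Finset.range (i + 1), t ^ (i - j) / ((i - j).factorial : ℝ) *
      (1 / (j.factorial : ℝ)) = (t + 1) ^ i / (i.factorial : ℝ) := by
    rw [add_comm t 1, add_pow, Finset.sum_div]
    refine Finset.sum_congr rfl fun j hj => ?_
    rw [Nat.cast_choose ℝ (Finset.mem_range_succ_iff.mp hj)]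
    have : (i.factorial : ℝ) ≠ 0 := by positivity
    field_simp
    simp
  rw [e] at h
  refine h.congr_fun fun n => ?_
  rw [evolvedBasis_succ, Finset.mul_sum]
  exact Finset.sum_congr rfl fun j _ => by ring

/-- The negative binomial distribution is invariant under the discrete Laguerre semigroup. -/
lemma tsum_weight_mul_tsum_linTransition {t : ℝ} (hβ : 0 < β) (ht : 0 ≤ t) {g : ℕ → ℝ}
    (hg : ∀ m, 0 ≤ g m) :
    ∑' n, ENNReal.ofReal (weight β n) * ∑' j,
      ENNReal.ofReal (linTransition β (Real.exp t - 1) n j) *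
        ENNReal.ofReal (dilation (Real.exp (-t)) g j) =
      ∑' m, ENNReal.ofReal (weight β m) * ENNReal.ofReal (g m) := by
  have hτ : 0 ≤ Real.exp t - 1 := by linarith [Real.one_le_exp ht]
  have hσ0 : 0 ≤ Real.exp (-t) := (Real.exp_pos _).le
  have hσ1 : Real.exp (-t) ≤ 1 := Real.exp_le_one_iff.mpr (by linarith)
  -- The image of the law under the kernel of 𝕂_t. It is shown to have the factorial moments of
  -- `weight β`, hence to equal it.
  set μ : ℕ → ℝ≥0∞ := fun m => ∑' n, ENNReal.ofReal (weight β n) * ∑' j,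
      ENNReal.ofReal (linTransition β (Real.exp t - 1) n j) *
        ENNReal.ofReal (dilationKernel (Real.exp (-t)) j m) with hμ
  have key : ∀ g : ℕ → ℝ, (∀ m, 0 ≤ g m) →
      ∑' n, ENNReal.ofReal (weight β n) * ∑' j,
      ENNReal.ofReal (linTransition β (Real.exp t - 1) n j) *
        ENNReal.ofReal (dilation (Real.exp (-t)) g j) =
      ∑' m, μ m * ENNReal.ofReal (g m) := by
    intro g hg
    simp only [hμ, ofReal_dilation hσ0 hσ1 hg, ← ENNReal.tsum_mul_left, ← ENNReal.tsum_mul_right]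
    conv_rhs => rw [ENNReal.tsum_comm]
    refine tsum_congr fun n => ?_
    conv_rhs => rw [ENNReal.tsum_comm]
    exact tsum_congr fun j => tsum_congr fun m => by ring
  have hmom : ∀ i, ∑' m, μ m * ENNReal.ofReal (shiftedBasis β (i + 1) m) =
      ENNReal.ofReal (1 / (i.factorial : ℝ)) := by
    intro i
    have hW : ∀ n, 0 ≤ evolvedBasis β (i + 1) (Real.exp t - 1) n :=
      fun n => evolvedBasis_nonneg hβ _ hτ n
    have h1 := (hasSum_weight_mul_evolvedBasis hβ (Real.exp t - 1) i).mul_left (Real.exp (-t) ^ i)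
    have e : Real.exp (-t) ^ i * ((Real.exp t - 1 + 1) ^ i / (i.factorial : ℝ)) =
        1 / (i.factorial : ℝ) := by
      rw [sub_add_cancel, ← mul_div_assoc, ← mul_pow, ← Real.exp_add]; simp
    rw [e] at h1
    rw [← key _ (shiftedBasis_nonneg hβ (i + 1)), ← h1.tsum_eq, ENNReal.ofReal_tsum_of_nonneg
      (fun n => mul_nonneg (by positivity) (mul_nonneg (weight_pos hβ n).le (hW n))) h1.summable]
    refine tsum_congr fun n => ?_
    have h2 := (hasSum_linTransition_mul_shiftedBasis hβ hτ (i + 1) n).mul_left (Real.exp (-t) ^ i)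
    rw [mul_left_comm, ENNReal.ofReal_mul (weight_pos hβ n).le, ← h2.tsum_eq,
      ENNReal.ofReal_tsum_of_nonneg (fun j => mul_nonneg (by positivity) (mul_nonneg
        (linTransition_nonneg _ _ _ _) (shiftedBasis_nonneg hβ _ _))) h2.summable]
    congr 1
    refine tsum_congr fun j => ?_
    rw [dilation_shiftedBasis, ← ENNReal.ofReal_mul (linTransition_nonneg _ _ _ _), mul_left_comm]
  have hfin : ∀ m, μ m ≠ ∞ := by
    have h0 := hmom 0
    simp only [shiftedBasis, rising_zero, Nat.choose_zero_right, Nat.cast_one, div_one,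
      ENNReal.ofReal_one, mul_one] at h0
    exact ENNReal.ne_top_of_tsum_ne_top (h0.trans_ne ENNReal.ofReal_ne_top)
  have hμw : (fun m => (μ m).toReal) = weight β := by
    refine eq_weight_of_moments hβ (fun m => ENNReal.toReal_nonneg) fun i => ?_
    have h := (hasSum_of_tsum_ofReal (f := fun m => (μ m).toReal * shiftedBasis β (i + 1) m)
      (a := 1 / (i.factorial : ℝ))
      (fun m => mul_nonneg ENNReal.toReal_nonneg (shiftedBasis_nonneg hβ _ _))
      (by positivity) (by
        rw [← hmom i]
        refine tsum_congr fun m => ?_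
        rw [ENNReal.ofReal_mul ENNReal.toReal_nonneg, ENNReal.ofReal_toReal (hfin m)])).mul_left
      (rising β i)
    have hr := (rising_pos hβ i).ne'
    rw [mul_one_div] at h
    refine h.congr_fun fun m => ?_
    rw [shiftedBasis]; field_simp
  rw [key g hg]
  refine tsum_congr fun m => ?_
  rw [← congrFun hμw m, ENNReal.ofReal_toReal (hfin m)]

end Moments

/-- Jensen's inequality for the square and a discrete probability distribution. -/
lemma sq_tsum_mul_le {ι : Type*} {q x : ι → ℝ} (hq : ∀ i, 0 ≤ q i) (hq1 : HasSum q 1)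
    (hx : Summable fun i => q i * x i ^ 2) :
    (Summable fun i => q i * x i) ∧ (∑' i, q i * x i) ^ 2 ≤ ∑' i, q i * x i ^ 2 := by
  have hs : Summable fun i => q i * x i := by
    rw [← summable_abs_iff]
    refine Summable.of_nonneg_of_le (fun i => abs_nonneg _) (fun i => ?_) (hq1.summable.add hx)
    rw [abs_mul, abs_of_nonneg (hq i), ← mul_one_add, ← sq_abs (x i)]
    have := hq i
    gcongr
    nlinarith [sq_nonneg (|x i| - 1), abs_nonneg (x i)]
  refine ⟨hs, ?_⟩
  set c := ∑' i, q i * x i with hc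
  have h := (hx.hasSum.sub (hs.hasSum.mul_left (2 * c))).add (hq1.mul_left (c ^ 2))
  have h0 := h.nonneg fun i => by
    have : q i * x i ^ 2 - 2 * c * (q i * x i) + c ^ 2 * q i = q i * (x i - c) ^ 2 := by ring
    rw [this]
    exact mul_nonneg (hq i) (sq_nonneg _)
  rw [← hc] at h0
  linarith

/-! ### The semigroup as a contraction of L². -/

section Contraction

variable {β t : ℝ}

/-- Invariance applied to g². All weights are positive, so finiteness of the total gives convergence
at every single n. -/
lemma laguerreSemigroup_sq (hβ : 0 < β) (ht : 0 ≤ t) {g : ℕ → ℝ}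
    (hg : MemLp g 2 (invMeasure β)) :
    (∀ n, Summable fun m => linTransition β (Real.exp t - 1) n m *
      dilation (Real.exp (-t)) (fun m => g m ^ 2) m) ∧
    HasSum (fun n => weight β n * laguerreSemigroup β t (fun m => g m ^ 2) n)
      (∑' n, weight β n * g n ^ 2) := by
  have hσ0 : 0 ≤ Real.exp (-t) := (Real.exp_pos _).le
  have hσ1 : Real.exp (-t) ≤ 1 := Real.exp_le_one_iff.mpr (by linarith)
  rw [memLp_two_invMeasure_iff hβ] at hg
  have hD : ∀ j, 0 ≤ dilation (Real.exp (-t)) (fun m => g m ^ 2) j := fun j =>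
    Finset.sum_nonneg fun m _ =>
      mul_nonneg (dilationKernel_nonneg hσ0 hσ1 j m) (sq_nonneg (g m))
  have hinv := tsum_weight_mul_tsum_linTransition hβ ht (g := fun m => g m ^ 2)
    (fun m => sq_nonneg _)
  simp only [← ENNReal.ofReal_mul (linTransition_nonneg _ _ _ _),
    ← ENNReal.ofReal_mul (weight_pos hβ _).le] at hinv
  rw [← ENNReal.ofReal_tsum_of_nonneg (fun n => mul_nonneg (weight_pos hβ n).le (sq_nonneg _))
    hg] at hinv
  have hs : ∀ n, Summable fun m => linTransition β (Real.exp t - 1) n m *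
      dilation (Real.exp (-t)) (fun m => g m ^ 2) m := by
    intro n
    have h1 := ENNReal.ne_top_of_tsum_ne_top (hinv.trans_ne ENNReal.ofReal_ne_top) n
    have h2 : ∑' m, ENNReal.ofReal (linTransition β (Real.exp t - 1) n m *
        dilation (Real.exp (-t)) (fun m => g m ^ 2) m) ≠ ∞ := by
      intro htop
      rw [htop, ENNReal.mul_top (by simpa using weight_pos hβ n)] at h1
      exact h1 rfl
    refine (ENNReal.summable_toReal h2).congr fun m => ?_
    rw [ENNReal.toReal_ofReal (mul_nonneg (linTransition_nonneg _ _ _ _) (hD m))]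
  refine ⟨hs, hasSum_of_tsum_ofReal (fun n => mul_nonneg (weight_pos hβ n).le
    (tsum_nonneg fun m => mul_nonneg (linTransition_nonneg _ _ _ _) (hD m)))
    (tsum_nonneg fun n => mul_nonneg (weight_pos hβ n).le (sq_nonneg _)) ?_⟩
  rw [← hinv]
  refine tsum_congr fun n => ?_
  rw [ENNReal.ofReal_mul (weight_pos hβ n).le, laguerreSemigroup, linSemigroup,
    ENNReal.ofReal_tsum_of_nonneg
      (fun m => mul_nonneg (linTransition_nonneg _ _ _ _) (hD m)) (hs n)]

lemma summable_linTransition_mul_dilation_sq (hβ : 0 < β) (ht : 0 ≤ t) {g : ℕ → ℝ}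
    (hg : MemLp g 2 (invMeasure β)) (n : ℕ) :
    Summable fun m => linTransition β (Real.exp t - 1) n m *
      dilation (Real.exp (-t)) g m ^ 2 := by
  refine Summable.of_nonneg_of_le
    (fun m => mul_nonneg (linTransition_nonneg _ _ _ _) (sq_nonneg _)) (fun m => ?_)
    ((laguerreSemigroup_sq hβ ht hg).1 n)
  exact mul_le_mul_of_nonneg_left (sq_dilation_le (Real.exp_pos _).le
    (Real.exp_le_one_iff.mpr (by linarith)) g m) (linTransition_nonneg _ _ _ _)

lemma summable_linTransition_mul_dilation (hβ : 0 < β) (ht : 0 ≤ t) {g : ℕ → ℝ}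
    (hg : MemLp g 2 (invMeasure β)) (n : ℕ) :
    Summable fun m => linTransition β (Real.exp t - 1) n m * dilation (Real.exp (-t)) g m :=
  (sq_tsum_mul_le (linTransition_nonneg _ _ _)
    (hasSum_linTransition hβ (by linarith [Real.one_le_exp ht]) n)
    (summable_linTransition_mul_dilation_sq hβ ht hg n)).1

/-- Jensen twice: for the law of the chain, then for the binomial law of the dilation. -/
lemma sq_laguerreSemigroup_le (hβ : 0 < β) (ht : 0 ≤ t) {g : ℕ → ℝ}
    (hg : MemLp g 2 (invMeasure β)) (n : ℕ) :
    laguerreSemigroup β t g n ^ 2 ≤ laguerreSemigroup β t (fun m => g m ^ 2) n := by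
  refine (sq_tsum_mul_le (linTransition_nonneg _ _ _)
    (hasSum_linTransition hβ (by linarith [Real.one_le_exp ht]) n)
    (summable_linTransition_mul_dilation_sq hβ ht hg n)).2.trans ?_
  refine (summable_linTransition_mul_dilation_sq hβ ht hg n).tsum_le_tsum (fun m => ?_)
    ((laguerreSemigroup_sq hβ ht hg).1 n)
  exact mul_le_mul_of_nonneg_left (sq_dilation_le (Real.exp_pos _).le
    (Real.exp_le_one_iff.mpr (by linarith)) g m) (linTransition_nonneg _ _ _ _)

lemma memLp_laguerreSemigroup (hβ : 0 < β) (ht : 0 ≤ t) {g : ℕ → ℝ}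
    (hg : MemLp g 2 (invMeasure β)) : MemLp (laguerreSemigroup β t g) 2 (invMeasure β) := by
  rw [memLp_two_invMeasure_iff hβ]
  exact Summable.of_nonneg_of_le (fun n => mul_nonneg (weight_pos hβ n).le (sq_nonneg _))
    (fun n => mul_le_mul_of_nonneg_left (sq_laguerreSemigroup_le hβ ht hg n) (weight_pos hβ n).le)
    (laguerreSemigroup_sq hβ ht hg).2.summable

lemma tsum_weight_mul_sq_laguerreSemigroup_le (hβ : 0 < β) (ht : 0 ≤ t) {g : ℕ → ℝ}
    (hg : MemLp g 2 (invMeasure β)) :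
    ∑' n, weight β n * laguerreSemigroup β t g n ^ 2 ≤ ∑' n, weight β n * g n ^ 2 := by
  rw [← (laguerreSemigroup_sq hβ ht hg).2.tsum_eq]
  exact ((memLp_two_invMeasure_iff hβ).mp (memLp_laguerreSemigroup hβ ht hg)).tsum_le_tsum
    (fun n => mul_le_mul_of_nonneg_left (sq_laguerreSemigroup_le hβ ht hg n) (weight_pos hβ n).le)
    (laguerreSemigroup_sq hβ ht hg).2.summable

lemma dilation_add (σ : ℝ) (f g : ℕ → ℝ) (n : ℕ) :
    dilation σ (f + g) n = dilation σ f n + dilation σ g n := by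
  simp only [dilation, Pi.add_apply, mul_add, Finset.sum_add_distrib]

lemma dilation_smul (σ c : ℝ) (g : ℕ → ℝ) (n : ℕ) :
    dilation σ (c • g) n = c * dilation σ g n := by
  simp only [dilation, Pi.smul_apply, smul_eq_mul, Finset.mul_sum]
  exact Finset.sum_congr rfl fun m _ => by ring

lemma laguerreSemigroup_add (hβ : 0 < β) (ht : 0 ≤ t) {f g : ℕ → ℝ}
    (hf : MemLp f 2 (invMeasure β)) (hg : MemLp g 2 (invMeasure β)) :
    laguerreSemigroup β t (f + g) = laguerreSemigroup β t f + laguerreSemigroup β t g := by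
  funext n
  simp only [laguerreSemigroup, linSemigroup, dilation_add, mul_add, Pi.add_apply]
  exact (summable_linTransition_mul_dilation hβ ht hf n).tsum_add
    (summable_linTransition_mul_dilation hβ ht hg n)

lemma laguerreSemigroup_smul (β t c : ℝ) (g : ℕ → ℝ) :
    laguerreSemigroup β t (c • g) = c • laguerreSemigroup β t g := by
  funext n
  simp only [laguerreSemigroup, linSemigroup, dilation_smul, Pi.smul_apply, smul_eq_mul,
    ← tsum_mul_left]
  exact tsum_congr fun m => by ring

end Contraction

/-! ### Completeness, spectral expansion and spectral gap. -/

section Hilbert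

variable {β t : ℝ}

/-- Every point has positive mass. Elements of `Lp` are therefore genuine functions, and pointwise
formulas for the semigroup transfer to them. -/
lemma eq_of_ae_eq_invMeasure (hβ : 0 < β) {f g : ℕ → ℝ} (h : f =ᵐ[invMeasure β] g) : f = g := by
  funext n
  have h1 := (ae_iff_of_countable.mp h) n
  apply h1
  rw [invMeasure, Measure.sum_apply _ (measurableSet_singleton n)]
  intro h0
  have h2 := ENNReal.tsum_eq_zero.mp h0 n
  simp only [Measure.smul_apply, Measure.dirac_apply, Set.mem_singleton_iff, Set.indicator_of_mem,
    Pi.one_apply, smul_eq_mul, mul_one, ENNReal.ofReal_eq_zero] at h2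
  exact h2.not_gt (weight_pos hβ n)

lemma inner_toLp {f g : ℕ → ℝ} (hf : MemLp f 2 (invMeasure β)) (hg : MemLp g 2 (invMeasure β)) :
    inner ℝ (hf.toLp f) (hg.toLp g) = ∫ n, f n * g n ∂(invMeasure β) := by
  rw [L2.inner_def]
  refine integral_congr_ae ?_
  filter_upwards [hf.coeFn_toLp, hg.coeFn_toLp] with n h1 h2
  rw [h1, h2]
  simp [mul_comm]

lemma sq_norm_toLp (hβ : 0 < β) {f : ℕ → ℝ} (hf : MemLp f 2 (invMeasure β)) :
    ‖hf.toLp f‖ ^ 2 = ∑' n, weight β n * f n ^ 2 := by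
  rw [← real_inner_self_eq_norm_sq, inner_toLp]
  refine integral_invMeasure hβ ?_
  simp only [← sq]
  exact ((memLp_two_invMeasure_iff hβ).mp hf).hasSum

lemma coeFn_toLp_eq (hβ : 0 < β) {f : ℕ → ℝ} (hf : MemLp f 2 (invMeasure β)) :
    (hf.toLp f : ℕ → ℝ) = f := eq_of_ae_eq_invMeasure hβ hf.coeFn_toLp

/-- The discrete Laguerre semigroup as a contraction of `L²`. -/
noncomputable def laguerreCLM (hβ : 0 < β) (ht : 0 ≤ t) :
    Lp ℝ 2 (invMeasure β) →L[ℝ] Lp ℝ 2 (invMeasure β) :=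
  LinearMap.mkContinuous
    { toFun := fun f => (memLp_laguerreSemigroup hβ ht (Lp.memLp f)).toLp _
      map_add' := fun f g => by
        rw [← MemLp.toLp_add]
        congr 1
        rw [eq_of_ae_eq_invMeasure hβ (Lp.coeFn_add f g),
          laguerreSemigroup_add hβ ht (Lp.memLp f) (Lp.memLp g)]
      map_smul' := fun c f => by
        rw [RingHom.id_apply, ← MemLp.toLp_const_smul]
        congr 1
        rw [eq_of_ae_eq_invMeasure hβ (Lp.coeFn_smul c f), laguerreSemigroup_smul] } 1 (by
    intro f
    rw [one_mul, ← sq_le_sq₀ (norm_nonneg _) (norm_nonneg _)]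
    have h : ‖f‖ ^ 2 = ∑' n, weight β n * f n ^ 2 := by
      rw [← sq_norm_toLp hβ (Lp.memLp f), Lp.toLp_coeFn]
    rw [h]
    exact (sq_norm_toLp hβ (memLp_laguerreSemigroup hβ ht (Lp.memLp f))).trans_le
      (tsum_weight_mul_sq_laguerreSemigroup_le hβ ht (Lp.memLp f)))

lemma laguerreCLM_toLp (hβ : 0 < β) (ht : 0 ≤ t) {g : ℕ → ℝ} (hg : MemLp g 2 (invMeasure β)) :
    laguerreCLM hβ ht (hg.toLp g) = (memLp_laguerreSemigroup hβ ht hg).toLp _ := by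
  change MemLp.toLp _ (memLp_laguerreSemigroup hβ ht (Lp.memLp (hg.toLp g))) = _
  congr 1
  rw [coeFn_toLp_eq hβ hg]

/-- The normalized discrete Laguerre polynomials as elements of `L²`. -/
noncomputable def laguerreVec (hβ : 0 < β) (k : ℕ) : Lp ℝ 2 (invMeasure β) :=
  √(2 ^ k * normConst β k) • (memLp_discreteLaguerre hβ k).toLp _

lemma two_pow_mul_normConst_pos (hβ : 0 < β) (k : ℕ) : 0 < 2 ^ k * normConst β k := by
  have := rising_pos hβ k
  rw [normConst_eq hβ]; positivity

lemma orthonormal_laguerreVec (hβ : 0 < β) : Orthonormal ℝ (laguerreVec hβ) := by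
  rw [orthonormal_iff_ite]
  intro j k
  rw [laguerreVec, laguerreVec, real_inner_smul_left, real_inner_smul_right, inner_toLp,
    integral_discreteLaguerre_mul hβ]
  have h := two_pow_mul_normConst_pos hβ k
  split_ifs with hjk
  · subst hjk
    rw [← mul_assoc, Real.mul_self_sqrt h.le, mul_inv_cancel₀ h.ne']
  · simp

lemma integrable_mul {f g : ℕ → ℝ} (hf : MemLp f 2 (invMeasure β))
    (hg : MemLp g 2 (invMeasure β)) : Integrable (fun n => f n * g n) (invMeasure β) :=
  hf.integrable_mul hg

/-- The change of basis from the e_i to the L_k is triangular with nonzero diagonal. -/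
lemma integral_mul_shiftedBasis_eq_zero (hβ : 0 < β) {g : ℕ → ℝ} (hg : MemLp g 2 (invMeasure β))
    (h : ∀ k, ∫ n, g n * discreteLaguerre β k n ∂(invMeasure β) = 0) (k : ℕ) :
    ∫ n, g n * shiftedBasis β (k + 1) n ∂(invMeasure β) = 0 := by
  induction k using Nat.strong_induction_on with
  | _ k ih =>
    have h1 := h k
    simp only [discreteLaguerre_eq_sum hβ, Finset.mul_sum] at h1
    have hint : ∀ i, Integrable (fun n => g n * (rising β k / 2 ^ k *
        ((-1) ^ i / ((k - i).factorial : ℝ)) * shiftedBasis β (i + 1) n)) (invMeasure β) := by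
      intro i
      have := (integrable_mul hg (memLp_shiftedBasis hβ i)).const_mul
        (rising β k / 2 ^ k * ((-1) ^ i / ((k - i).factorial : ℝ)))
      exact this.congr (ae_of_all _ fun n => by ring)
    rw [integral_finsetSum _ fun i _ => hint i] at h1
    have h2 : ∀ i, ∫ n, g n * (rising β k / 2 ^ k * ((-1) ^ i / ((k - i).factorial : ℝ)) *
        shiftedBasis β (i + 1) n) ∂(invMeasure β) = rising β k / 2 ^ k *
        ((-1) ^ i / ((k - i).factorial : ℝ)) *
        ∫ n, g n * shiftedBasis β (i + 1) n ∂(invMeasure β) := fun i => by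
      rw [← integral_const_mul]
      congr 1; funext n; ring
    simp only [h2] at h1
    rw [Finset.sum_range_succ, Finset.sum_eq_zero, zero_add] at h1
    · have hr := (rising_pos hβ k).ne'
      refine (mul_eq_zero.mp h1).resolve_left ?_
      have : ((k - k).factorial : ℝ) ≠ 0 := by positivity
      exact mul_ne_zero (div_ne_zero hr (by positivity)) (div_ne_zero (by simp) this)
    · intro i hi
      rw [ih i (Finset.mem_range.mp hi), mul_zero]

/-- The discrete Laguerre polynomials are complete. -/
lemma eq_zero_of_integral_mul_discreteLaguerre (hβ : 0 < β) {g : ℕ → ℝ}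
    (hg : MemLp g 2 (invMeasure β))
    (h : ∀ k, ∫ n, g n * discreteLaguerre β k n ∂(invMeasure β) = 0) : g = 0 := by
  have hw := weight_pos hβ
  -- From |g| (5/4)^n ≤ g² + (5/4)^{2n}, where again (5/4)² < 2.
  have hsum : Summable fun n => |weight β n * g n| * (1 + 1 / 4) ^ n := by
    have h1 := (memLp_two_invMeasure_iff hβ).mp hg
    have h2 := summable_weight_mul_pow hβ (z := (5 / 4) ^ 2) (by norm_num) (by norm_num)
    refine Summable.of_nonneg_of_le (fun n => by positivity) (fun n => ?_) (h1.add h2)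
    rw [abs_mul, abs_of_pos (hw n), ← mul_add, mul_assoc, ← pow_mul, mul_comm 2 n, pow_mul,
      ← sq_abs (g n)]
    have := (hw n).le
    gcongr
    rw [show (1 + 1 / 4 : ℝ) = 5 / 4 by norm_num]
    have h5 : (0 : ℝ) ≤ (5 / 4) ^ n := by positivity
    nlinarith [sq_nonneg (|g n| - (5 / 4) ^ n), abs_nonneg (g n), mul_nonneg (abs_nonneg (g n)) h5]
  have h0 := eq_zero_of_tsum_mul_choose_eq_zero (f := fun n => weight β n * g n)
    (x₀ := 1 / 4) (by norm_num) hsum (fun i => by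
      have h1 := hasSum_integral_invMeasure hβ (integrable_mul hg (memLp_shiftedBasis hβ i))
      rw [integral_mul_shiftedBasis_eq_zero hβ hg h] at h1
      have h2 := (h1.mul_left (rising β i)).tsum_eq
      rw [mul_zero] at h2
      rw [← h2]
      refine tsum_congr fun n => ?_
      have hr := (rising_pos hβ i).ne'
      rw [shiftedBasis]; field_simp)
  funext n
  exact (mul_eq_zero.mp (congrFun h0 n)).resolve_left (hw n).ne'

lemma inner_laguerreVec_toLp (hβ : 0 < β) {g : ℕ → ℝ} (hg : MemLp g 2 (invMeasure β)) (k : ℕ) :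
    inner ℝ (laguerreVec hβ k) (hg.toLp g) = √(2 ^ k * normConst β k) *
      ∫ n, g n * discreteLaguerre β k n ∂(invMeasure β) := by
  rw [laguerreVec, real_inner_smul_left, inner_toLp]
  simp only [mul_comm]

/-- The normalized discrete Laguerre polynomials as a Hilbert basis. -/
noncomputable def laguerreBasis (hβ : 0 < β) : HilbertBasis ℕ ℝ (Lp ℝ 2 (invMeasure β)) :=
  HilbertBasis.mkOfOrthogonalEqBot (orthonormal_laguerreVec hβ) (by
    rw [Submodule.eq_bot_iff]
    intro f hf
    rw [Submodule.mem_orthogonal] at hf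
    have h : (f : ℕ → ℝ) = 0 := by
      refine eq_zero_of_integral_mul_discreteLaguerre hβ (Lp.memLp f) fun k => ?_
      have h1 := hf _ (Submodule.subset_span (Set.mem_range_self k))
      rw [← Lp.toLp_coeFn f (Lp.memLp f), inner_laguerreVec_toLp] at h1
      exact (mul_eq_zero.mp h1).resolve_left
        (Real.sqrt_pos.mpr (two_pow_mul_normConst_pos hβ k)).ne'
    rw [← Lp.toLp_coeFn f (Lp.memLp f)]
    simp only [h]
    exact MemLp.toLp_zero _)

lemma coe_laguerreBasis (hβ : 0 < β) : ⇑(laguerreBasis hβ) = laguerreVec hβ :=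
  HilbertBasis.coe_mkOfOrthogonalEqBot _ _

lemma laguerreCLM_laguerreVec (hβ : 0 < β) (ht : 0 ≤ t) (k : ℕ) :
    laguerreCLM hβ ht (laguerreVec hβ k) = Real.exp (-(k * t)) • laguerreVec hβ k := by
  rw [laguerreVec, map_smul, laguerreCLM_toLp, smul_comm]
  congr 1
  rw [← MemLp.toLp_const_smul]
  congr 1
  funext n
  exact laguerreSemigroup_discreteLaguerre hβ ht k n

/-- Boundedness allows the operator to be applied termwise to the expansion of f, so
self-adjointness is not required. -/
lemma inner_laguerreVec_laguerreCLM (hβ : 0 < β) (ht : 0 ≤ t) (f : Lp ℝ 2 (invMeasure β))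
    (k : ℕ) :
    inner ℝ (laguerreVec hβ k) (laguerreCLM hβ ht f) =
      Real.exp (-(k * t)) * inner ℝ (laguerreVec hβ k) f := by
  have h := (((laguerreBasis hβ).hasSum_repr f).mapL (laguerreCLM hβ ht)).mapL
    (innerSL ℝ (laguerreVec hβ k))
  simp only [innerSL_apply_apply, map_smul, coe_laguerreBasis, laguerreCLM_laguerreVec,
    orthonormal_iff_ite.mp (orthonormal_laguerreVec hβ) k,
    HilbertBasis.repr_apply_apply, smul_eq_mul] at h
  refine h.unique ?_
  refine (hasSum_ite_eq k (Real.exp (-(k * t)) * inner ℝ (laguerreVec hβ k) f)).congr_fun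
    fun j => ?_
  by_cases hj : j = k
  · subst hj; simp [mul_comm]
  · simp [hj, Ne.symm hj]

lemma hasSum_laguerreSemigroup (hβ : 0 < β) (ht : 0 ≤ t) {g : ℕ → ℝ}
    (hg : MemLp g 2 (invMeasure β)) :
    HasSum (fun k : ℕ => (Real.exp (-(k * t)) * (2 ^ k * normConst β k) *
        ∫ n, g n * discreteLaguerre β k n ∂(invMeasure β)) •
          (memLp_discreteLaguerre hβ k).toLp (discreteLaguerre β k))
      ((memLp_laguerreSemigroup hβ ht hg).toLp (laguerreSemigroup β t g)) := by
  have h := ((laguerreBasis hβ).hasSum_repr (hg.toLp g)).mapL (laguerreCLM hβ ht)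
  rw [laguerreCLM_toLp] at h
  refine h.congr_fun fun k => ?_
  rw [map_smul, HilbertBasis.repr_apply_apply, coe_laguerreBasis, laguerreCLM_laguerreVec,
    inner_laguerreVec_toLp, laguerreVec, smul_smul, smul_smul]
  congr 1
  have := Real.mul_self_sqrt (two_pow_mul_normConst_pos hβ k).le
  linear_combination -(Real.exp (-(k * t)) *
    ∫ n, g n * discreteLaguerre β k n ∂(invMeasure β)) * this

/-- The spectral gap inequality. -/
lemma norm_laguerreCLM_le (hβ : 0 < β) (ht : 0 ≤ t) {f : Lp ℝ 2 (invMeasure β)}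
    (hf : inner ℝ (laguerreVec hβ 0) f = 0) : ‖laguerreCLM hβ ht f‖ ≤ Real.exp (-t) * ‖f‖ := by
  -- Parseval for both sides, compared term by term: the k = 0 term vanishes and e^{-kt} ≤ e^{-t}
  -- for k ≥ 1.
  have h1 := (laguerreBasis hβ).hasSum_inner_mul_inner (laguerreCLM hβ ht f) (laguerreCLM hβ ht f)
  have h2 := ((laguerreBasis hβ).hasSum_inner_mul_inner f f).mul_left (Real.exp (-t) ^ 2)
  rw [real_inner_self_eq_norm_sq] at h1 h2
  rw [← mul_pow] at h2
  refine le_of_sq_le_sq ?_ (by positivity)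
  refine hasSum_le (fun k => ?_) h1 h2
  rw [real_inner_comm, real_inner_comm (laguerreBasis hβ k) f, coe_laguerreBasis,
    inner_laguerreVec_laguerreCLM]
  cases k with
  | zero => rw [hf]; simp
  | succ k =>
    have hexp : Real.exp (-((k + 1 : ℕ) * t)) ≤ Real.exp (-t) := by
      rw [Real.exp_le_exp]; push_cast; nlinarith [mul_nonneg k.cast_nonneg ht]
    have h0 := mul_self_nonneg (inner ℝ (laguerreVec hβ (k + 1)) f)
    calc _ = Real.exp (-((k + 1 : ℕ) * t)) ^ 2 * (inner ℝ (laguerreVec hβ (k + 1)) f *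
          inner ℝ (laguerreVec hβ (k + 1)) f) := by ring
      _ ≤ _ := by gcongr

lemma discreteLaguerre_zero (hβ : 0 < β) : discreteLaguerre β 0 = fun _ => 1 := by
  funext n
  rw [discreteLaguerre_eq_sum hβ]
  simp [shiftedBasis, rising_zero]

/-- The semigroup fixes constants and preserves the mean, so centring commutes with it; the centred
function is orthogonal to L_0 = 1. -/
lemma var_laguerreSemigroup_le (hβ : 0 < β) (ht : 0 ≤ t) {g : ℕ → ℝ}
    (hg : MemLp g 2 (invMeasure β)) :
    var (invMeasure β) (laguerreSemigroup β t g) ≤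
      Real.exp (-t) * var (invMeasure β) g := by
  have hone : MemLp (fun _ : ℕ => (1 : ℝ)) 2 (invMeasure β) :=
    discreteLaguerre_zero hβ ▸ memLp_discreteLaguerre hβ 0
  have hK1 : laguerreSemigroup β t (fun _ => 1) = fun _ => 1 := by
    funext n
    have := laguerreSemigroup_discreteLaguerre hβ ht 0 n
    rw [discreteLaguerre_zero hβ] at this
    simpa using this
  have hc : normConst β 0 = 1 := by rw [normConst_eq hβ]; simp [rising_zero]
  have hinner : ∀ {f : ℕ → ℝ} (hf : MemLp f 2 (invMeasure β)),
      inner ℝ (laguerreVec hβ 0) (hf.toLp f) = ∫ n, f n ∂(invMeasure β) := fun hf => by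
    rw [inner_laguerreVec_toLp]
    simp only [discreteLaguerre_zero hβ, hc, pow_zero, mul_one, Real.sqrt_one, one_mul]
  have hK := memLp_laguerreSemigroup hβ ht hg
  have hmean : ∫ n, laguerreSemigroup β t g n ∂(invMeasure β) = ∫ n, g n ∂(invMeasure β) := by
    rw [← hinner hK, ← hinner hg, ← laguerreCLM_toLp hβ ht hg, inner_laguerreVec_laguerreCLM]
    simp
  set c := ∫ n, g n ∂(invMeasure β) with hcdef
  have hsub : (fun n => g n - c) = g + (-c) • fun _ => (1 : ℝ) := by
    funext n; simp [sub_eq_add_neg]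
  have hf : MemLp (fun n => g n - c) 2 (invMeasure β) := hsub ▸ hg.add (hone.const_smul (-c))
  have hKf : laguerreSemigroup β t (fun n => g n - c) = fun n => laguerreSemigroup β t g n - c := by
    rw [hsub, laguerreSemigroup_add hβ ht hg (hone.const_smul (-c)), laguerreSemigroup_smul, hK1]
    funext n; simp [sub_eq_add_neg]
  have h1 : ∫ _, (1 : ℝ) ∂(invMeasure β) = 1 := by
    have := integral_discreteLaguerre_mul hβ 0 0
    simpa [discreteLaguerre_zero hβ, hc] using this
  have hzero : inner ℝ (laguerreVec hβ 0) (hf.toLp _) = 0 := by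
    have hgi := integrable_mul hg hone
    have h1i := integrable_mul hone hone
    simp only [mul_one] at hgi h1i
    rw [hinner]
    have h2 := integral_sub hgi (h1i.const_mul c)
    rw [integral_const_mul, h1] at h2
    simpa [← hcdef] using h2
  have hmain := norm_laguerreCLM_le hβ ht hzero
  rw [laguerreCLM_toLp, Lp.norm_toLp, Lp.norm_toLp] at hmain
  simp only [hKf] at hmain
  rw [var, var, hmean]
  exact hmain

end Hilbert

end DiscreteLaguerre

theorem proposition5 (β : ℝ) (hβ : 0 < β) :
    ∃ hL : ∀ k : ℕ, MemLp (DiscreteLaguerre.discreteLaguerre β k) 2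
        (DiscreteLaguerre.invMeasure β),
      (∀ j k : ℕ,
        ∫ n, DiscreteLaguerre.discreteLaguerre β j n * DiscreteLaguerre.discreteLaguerre β k n
            ∂(DiscreteLaguerre.invMeasure β) =
          if j = k then (2 ^ k * DiscreteLaguerre.normConst β k)⁻¹ else 0) ∧
      ∀ t : ℝ, 0 < t →
        (∀ k n : ℕ,
          DiscreteLaguerre.laguerreSemigroup β t (DiscreteLaguerre.discreteLaguerre β k) n =
            Real.exp (-(k * t)) * DiscreteLaguerre.discreteLaguerre β k n) ∧
        ∀ g : ℕ → ℝ, MemLp g 2 (DiscreteLaguerre.invMeasure β) →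
          (∀ n : ℕ, Summable fun m : ℕ =>
            DiscreteLaguerre.linTransition β (Real.exp t - 1) n m *
              DiscreteLaguerre.dilation (Real.exp (-t)) g m) ∧
          ∃ hK : MemLp (DiscreteLaguerre.laguerreSemigroup β t g) 2
              (DiscreteLaguerre.invMeasure β),
            HasSum
              (fun k : ℕ =>
                (Real.exp (-(k * t)) * (2 ^ k * DiscreteLaguerre.normConst β k) *
                  ∫ n, g n * DiscreteLaguerre.discreteLaguerre β k n
                    ∂(DiscreteLaguerre.invMeasure β)) •
                  (hL k).toLp (DiscreteLaguerre.discreteLaguerre β k))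
              (hK.toLp (DiscreteLaguerre.laguerreSemigroup β t g)) ∧
            DiscreteLaguerre.var (DiscreteLaguerre.invMeasure β)
                (DiscreteLaguerre.laguerreSemigroup β t g) ≤
              Real.exp (-t) * DiscreteLaguerre.var (DiscreteLaguerre.invMeasure β) g :=
  ⟨DiscreteLaguerre.memLp_discreteLaguerre hβ, DiscreteLaguerre.integral_discreteLaguerre_mul hβ,
    fun _ ht => ⟨DiscreteLaguerre.laguerreSemigroup_discreteLaguerre hβ ht.le, fun _ hg =>
      ⟨DiscreteLaguerre.summable_linTransition_mul_dilation hβ ht.le hg,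
        DiscreteLaguerre.memLp_laguerreSemigroup hβ ht.le hg,
        DiscreteLaguerre.hasSum_laguerreSemigroup hβ ht.le hg,
        DiscreteLaguerre.var_laguerreSemigroup_le hβ ht.le hg⟩⟩⟩
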